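/- \textbf{Trees.} A tree is a partially ordered set $(T,\le_T)$ that has a minimum, in which every node has a finite well-ordered set of predecessors and finitely many immediate successors, and all of whose maximal chains have the same cardinality, called the height of $T$. The level of a node is the number of its predecessors, and $T(n)$ is the set of nodes of level $n$. A vector tree of infinite height is a finite sequence $\mathbf T=(T_1,\dots,T_d)$, $d\ge 1$, of trees of height $\omega$. Its level product $\otimes\mathbf T=\bigcup_{n}T_1(n)\times\dots\times T_d(n)$ is ordered coordinatewise; it is a tree with levels $\otimes\mathbf T(n)=T_1(n)\times\dots\times T_d(n)$, and for $m\le n$ we put $\otimes\mathbf T\upharpoonright[m,n)=\bigcup_{m\le k<n}\otimes\mathbf T(k)$. A vector level subset of $\mathbf T$ at level $k$ is a tuple $\mathbf D=(D_1,\dots,D_d)$ with $\emptyset\ne D_i\subseteq T_i(k)$ for all $i$; put $\otimes\mathbf D=D_1\times\dots\times D_d$. It dominates $\mathbf T(n)$ if for all $i$ every $t\in T_i(n)$ has some $s\in D_i$ with $t\le_{T_i}s$. \textbf{Words.} Let $\Lambda$ be a finite set and let $(v_s)_{s\in\otimes\mathbf T}$ be distinct symbols not in $\Lambda$. A constant word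 is a map $f:\otimes\mathbf T\upharpoonright[m,n)\to\Lambda$ with $m\le n$; $W(\Lambda,\mathbf T)$ is the set of all constant words. A variable word $f$ with $\mathrm{ws}(f)=\mathbf D$ is a map $f:\otimes\mathbf T\upharpoonright[m,n)\to\Lambda\cup\{v_s:s\in\otimes\mathbf D\}$, where $\mathbf D$ is a vector level subset of $\mathbf T$ at some level in $[m,n)$, such that for each $s\in\otimes\mathbf D$ the set $f^{-1}(v_s)$ is nonempty with minimum $s$, and all the sets $f^{-1}(v_s)$, $s\in\otimes\mathbf D$, meet the same levels of $\otimes\mathbf T$. For a nonempty word $f$ (constant or variable) with domain $\otimes\mathbf T\upharpoonright[m,n)$ put $\mathrm{bot}(f)=m$ and $\mathrm{top}(f)=n$. A sequence $(f_i)_{i\ge0}$ of nonempty words is compatible if $\mathrm{top}(f_i)=\mathrm{bot}(f_{i+1})$ for all $i$. The span $[f]_\Lambda$ of a variable word $f$ is the set of all constant words obtained from $f$ by replacing, for each $s\in\otimes\mathrm{ws}(f)$, all occurrences of $v_s$ by a letter $a_s\in\Lambda$. \textbf{Subspaces.} A subspace is a compatible infinite sequence $X=(f_i)_{i\ge0}$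 of variable words such that $\mathrm{bot}(f_0)=0$ and $\mathrm{ws}(f_i)$ dominates $\mathbf T(i)$ for every $i$. Its span is $$[X]_\Lambda=\{g_0\cup\dots\cup g_{q-1}:\ q\ge1,\ g_i\in[f_i]_\Lambda\text{ for all }i<q\},$$ and $X'\le X$ means $[X']_\Lambda\subseteq[X]_\Lambda$. Let $W^{[\infty]}(\Lambda,\mathbf T)$ be the set of all compatible infinite sequences $(g_n)_{n\ge0}$ of nonempty constant words with $\mathrm{bot}(g_0)=0$, with the topology induced from the product space $W(\Lambda,\mathbf T)^{\omega}$, where $W(\Lambda,\mathbf T)$ is discrete. For a subspace $X$ let $[X]^{[\infty]}_\Lambda$ be the set of all $(g_n)_{n\ge0}\in W^{[\infty]}(\Lambda,\mathbf T)$ with $g_0\cup\dots\cup g_{n-1}\in[X]_\Lambda$ for every $n\ge1$. \textbf{Souslin measurability.} The Souslin measurable subsets of a topological space form the smallest algebra of sets that contains the open sets and is closed under the Souslin operation $(A_s)_{s\in\omega^{<\infty}}\mapsto\bigcup_{\sigma\in\omega^\omega}\bigcap_{n\in\omega}A_{\sigma\upharpoonright n}$. A coloring is Souslin measurable if the preimage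 of each color is. \textbf{Theorem.} Let $\Lambda$ be a finite alphabet and $\mathbf T$ a vector tree of infinite height. For every Souslin measurable coloring of $W^{[\infty]}(\Lambda,\mathbf T)$ with finitely many colors and every subspace $X$ there exists a subspace $X'\le X$ such that all elements of $[X']^{[\infty]}_\Lambda$ have the same color. -/

import Mathlib

open scoped Cardinal

namespace TreeHJ

universe u v

/-! ### Trees -/

/-- A tree: a partially ordered set with a minimum, in which the predecessors of every node form a
finite well ordered set (equivalently a finite chain), every node has finitely many immediate
successors, and all maximal chains have the same cardinality. -/
structure IsTree (S : Type u) [PartialOrder S] : Prop where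
  exists_root : ∃ r : S, ∀ t, r ≤ t
  pred_chain : ∀ t : S, IsChain (· ≤ ·) (Set.Iio t)
  pred_finite : ∀ t : S, (Set.Iio t).Finite
  imsuc_finite : ∀ t : S, {s : S | t ⋖ s}.Finite
  balanced : ∀ A B : Set S, IsMaxChain (· ≤ ·) A → IsMaxChain (· ≤ ·) B → #A = #B

/-- The tree `S` has height `κ`: every maximal chain of `S` has cardinality `κ`. -/
def HasHeight (S : Type u) [PartialOrder S] (κ : Cardinal.{u}) : Prop :=
  ∀ A : Set S, IsMaxChain (· ≤ ·) A → #A = κ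

/-- The number of predecessors of a node. -/
noncomputable def level {S : Type u} [PartialOrder S] (t : S) : ℕ := (Set.Iio t).ncard

/-- The set of levels that a subset of a tree meets. -/
def levelSet {S : Type u} [PartialOrder S] (D : Set S) : Set ℕ := level '' D

/-- `D` dominates `E`: every node of `E` lies below a node of `D`. -/
def Dominates {S : Type u} [PartialOrder S] (D E : Set S) : Prop := ∀ t ∈ E, ∃ s ∈ D, t ≤ s

/-! ### Level products -/

section LevelProducts

variable {d : ℕ} (T : Fin d → Type u) [∀ i, PartialOrder (T i)]

/-- The level product of the `T i` (each of infinite height): the tuples of nodes of a common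
level. It carries the coordinatewise order. -/
abbrev LevelProduct : Type u := {t : ∀ i, T i // ∃ n, ∀ i, level (t i) = n}

variable {T}

/-- The `n`-th level of the level product, that is, the product of the `n`-th levels. -/
def prodLevel (n : ℕ) : Set (LevelProduct T) := {t | ∀ i, level (t.1 i) = n}

/-- The set of levels that a subset of the level product meets. -/
def prodLevelSet (A : Set (LevelProduct T)) : Set ℕ := {n | (prodLevel n ∩ A).Nonempty}

variable (T) in
/-- The part of the level product that consists of the levels `k` with `m ≤ k < n`. -/
def slab (m n : ℕ) : Set (LevelProduct T) := {t | ∃ k, m ≤ k ∧ k < n ∧ t ∈ prodLevel k}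

/-- `D` is a vector level subset at level `k`: the level set of every component is `{k}`. -/
def IsVectorLevelSubset (D : ∀ i, Set (T i)) (k : ℕ) : Prop := ∀ i, levelSet (D i) = {k}

/-- The level product of a vector subset. -/
def subProduct (D : ∀ i, Set (T i)) : Set (LevelProduct T) := {t | ∀ i, t.1 i ∈ D i}

end LevelProducts

/-! ### Words -/

section Words

variable (Λ : Type v) {d : ℕ} (T : Fin d → Type u) [∀ i, PartialOrder (T i)]

/-- Partial functions on the level product. A value `Sum.inl a` is the letter `a`, a value
`Sum.inr s` is the variable `v_s`; `none` means that the function is undefined there. -/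
def PWord : Type (max u v) := LevelProduct T → Option (Λ ⊕ LevelProduct T)

variable {Λ T}

/-- The empty function. -/
def PWord.empty : PWord Λ T := fun _ => none

/-- The domain. -/
def PWord.dom (f : PWord Λ T) : Set (LevelProduct T) := {t | f t ≠ none}

/-- The union of two partial functions (with disjoint domains). -/
def PWord.union (f g : PWord Λ T) : PWord Λ T := fun t => (f t).or (g t)

/-- The union `g 0 ∪ ⋯ ∪ g (q - 1)`. -/
def PWord.unionUpTo (g : ℕ → PWord Λ T) : ℕ → PWord Λ T
  | 0 => PWord.empty
  | q + 1 => (PWord.unionUpTo g q).union (g q)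

/-- The set of positions at which the variable `v_s` occurs. -/
def PWord.occ (f : PWord Λ T) (s : LevelProduct T) : Set (LevelProduct T) :=
  {t | f t = some (Sum.inr s)}

/-- For a nonempty word with domain `slab T m n`, this is `m`. -/
noncomputable def PWord.bot (f : PWord Λ T) : ℕ := sInf (prodLevelSet f.dom)

/-- For a nonempty word with domain `slab T m n`, this is `n`. -/
noncomputable def PWord.top (f : PWord Λ T) : ℕ := sInf {n | f.dom ⊆ slab T 0 n}

/-- The constant words on `slab T m n`: all maps from `slab T m n` to `Λ`. -/
def constWords (m n : ℕ) : Set (PWord Λ T) :=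
  {f | f.dom = slab T m n ∧ ∀ t y, f t = some y → ∃ a : Λ, y = Sum.inl a}

variable (Λ T) in
/-- The set of all constant words, as a type. -/
def ConstWord : Type (max u v) := {f : PWord Λ T // ∃ m n, m ≤ n ∧ f ∈ constWords m n}

/-- The underlying partial function of a constant word. -/
def ConstWord.word (f : ConstWord Λ T) : PWord Λ T := f.1

/-- The set of constant words carries the discrete topology. -/
instance : TopologicalSpace (ConstWord Λ T) := ⊥

/-- The variable words on `slab T m n` with variables `v_s`, `s` in the level product of `D`. -/
def varWords (D : ∀ i, Set (T i)) (m n : ℕ) : Set (PWord Λ T) :=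
  {f | f.dom = slab T m n ∧
    (∀ t s, f t = some (Sum.inr s) → s ∈ subProduct D) ∧
    (∀ s ∈ subProduct D, IsLeast (f.occ s) s) ∧
    ∀ s ∈ subProduct D, ∀ s' ∈ subProduct D, prodLevelSet (f.occ s) = prodLevelSet (f.occ s')}

/-- `f` is a variable word whose (unique) vector level subset of variables is `D`. -/
def IsVarWord (f : PWord Λ T) (D : ∀ i, Set (T i)) : Prop :=
  ∃ k m n, IsVectorLevelSubset D k ∧ m ≤ k ∧ k < n ∧ f ∈ varWords D m n

/-- The constant word obtained from a variable word by replacing each `v_s` by `a s` (the values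
of `a` at variables that do not occur are irrelevant). -/
def PWord.subst (f : PWord Λ T) (a : LevelProduct T → Λ) : PWord Λ T :=
  fun t => (f t).map (Sum.elim Sum.inl fun s => Sum.inl (a s))

/-- The span of a variable word. -/
def PWord.span (f : PWord Λ T) : Set (PWord Λ T) := Set.range f.subst

/-- Compatibility of a pair of words. -/
def Compatible (f g : PWord Λ T) : Prop :=
  f = PWord.empty ∨ g = PWord.empty ∨ f.top = g.bot

/-- The span of an infinite compatible sequence of variable words: the union over `q ≥ 1` of the
sets of all `g 0 ∪ ⋯ ∪ g (q - 1)` with `g i` in the span of `X i`. -/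
def seqSpan (X : ℕ → PWord Λ T) : Set (PWord Λ T) :=
  {w | ∃ q, 1 ≤ q ∧ ∃ g : ℕ → PWord Λ T, (∀ i < q, g i ∈ (X i).span) ∧ w = PWord.unionUpTo g q}

/-- Subspaces: compatible sequences of variable words `X i`, starting at level `0`, such that the
vector level subset of variables of `X i` dominates the `i`-th level of the vector tree. -/
structure IsSubspace (X : ℕ → PWord Λ T) : Prop where
  compatible : ∀ i, Compatible (X i) (X (i + 1))
  varWord : ∀ i, ∃ D : ∀ j, Set (T j), IsVarWord (X i) D ∧
    ∀ j, Dominates (D j) {t : T j | level t = i}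
  bot_eq : (X 0).bot = 0

variable (Λ T) in
/-- The space of all infinite compatible sequences of nonempty constant words that start at
level `0`. -/
def WordSeq : Type (max u v) :=
  {A : ℕ → ConstWord Λ T // (∀ i, (A i).word ≠ PWord.empty) ∧
    (∀ i, Compatible (A i).word (A (i + 1)).word) ∧ (A 0).word.bot = 0}

/-- The topology induced by the product topology on sequences of constant words. -/
instance : TopologicalSpace (WordSeq Λ T) :=
  TopologicalSpace.induced (fun A : WordSeq Λ T => (A.1 : ℕ → ConstWord Λ T))
    Pi.topologicalSpace

/-- The sequences `A` in `WordSeq Λ T` such that `A 0 ∪ ⋯ ∪ A (n - 1)` lies in the span of `X` for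
every `n ≥ 1`. -/
def infSpan (X : ℕ → PWord Λ T) : Set (WordSeq Λ T) :=
  {A | ∀ n, 1 ≤ n → PWord.unionUpTo (fun i => (A.1 i).word) n ∈ seqSpan X}

end Words

/-! ### Souslin measurability -/

/-- The smallest algebra of subsets of `Y` that contains the open sets and is closed under the
Souslin operation. -/
inductive SouslinMeasurable {Y : Type u} [TopologicalSpace Y] : Set Y → Prop
  | of_isOpen (U : Set Y) : IsOpen U → SouslinMeasurable U
  | compl (A : Set Y) : SouslinMeasurable A → SouslinMeasurable Aᶜ
  | union (A B : Set Y) : SouslinMeasurable A → SouslinMeasurable B → SouslinMeasurable (A ∪ B)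
  | souslin (A : List ℕ → Set Y) : (∀ s, SouslinMeasurable (A s)) →
      SouslinMeasurable (⋃ σ : ℕ → ℕ, ⋂ n : ℕ, A ((List.range n).map σ))

end TreeHJ

namespace TreeHJ

/-! ### Abstract infinite-dimensional Ramsey theory -/

/-! This is a theorem of Ellentuck type. A point $(g_n)$ is coded by its partial unions, starting
with the empty word, each properly extending the one before. The proof has a topological half, which
only uses formal properties of such codes, and a combinatorial half, which supplies these
properties.

Topological half (`RamseySystem`). The inputs are a pigeonhole principle for the next word of an
approximation and an amalgamation principle that moves a refinement back to one with prescribed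
first blocks. Fusion and the dichotomy between accepting and rejecting show that open sets are
decided (`exists_decides_of_open`). Fusion also makes a countable union of decidable sets relatively
open (`Ramsey.iUnion`). For the Souslin operation, each set of points with a branch through $s$ gets
a decidable envelope, and one subspace avoids all the errors (`Ramsey.souslin`).

Combinatorial half. Under the union in which the first word wins, words form a semigroup, and the
span of a subspace together with the empty word is a subsemigroup. The Hales–Jewett theorem over the
alphabet of all maps $\otimes\mathbf T(n)\to\Lambda$ yields variable words with monochromatic
instances (`Frame.exists_mono_probe`). By compactness there are ultrafilters each of whose members
contains all instances of such words at arbitrarily high levels; they form a closed subsemigroup,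
which has an idempotent (`exists_idempotent_probeUltrafilter`). The Galvin–Glazer argument, run
block by block, gives the pigeonhole principle (`exists_pigeonhole`). -/

/-- The axioms for a topological Ramsey theorem in which the points are (coded by) infinite
`R`-increasing sequences of words and in which a subspace is an infinite sequence of blocks;
`Sp q X` is the set of words that use the first `q` blocks of `X`. -/
structure RamseySystem (B W P : Type*) where
  Sub : (ℕ → B) → Prop
  Sp : ℕ → (ℕ → B) → Set W
  R : W → W → Prop
  val : P → ℕ → W
  sub_of_local : ∀ Y, (∀ n, ∃ X, Sub X ∧ ∀ i < n, X i = Y i) → Sub Y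
  sp_congr : ∀ q X Y, (∀ i < q, X i = Y i) → Sp q X = Sp q Y
  sp_finite : ∀ q X, Sub X → (Sp q X).Finite
  depth_lt : ∀ X x y q r, Sub X → x ∈ Sp q X → y ∈ Sp r X → R x y → q < r
  rel_trans : ∀ x y z, R x y → R y z → R x z
  rel_val : ∀ A n, R (val A n) (val A (n + 1))
  pigeonhole : ∀ X x q (O : Set W), Sub X → x ∈ Sp q X → ∃ Y, Sub Y ∧ (∀ i < q, Y i = X i) ∧
    (∀ r, Sp r Y ⊆ ⋃ s, Sp s X) ∧
    ((∀ r, ∀ y ∈ Sp r Y, R x y → y ∈ O) ∨ (∀ r, ∀ y ∈ Sp r Y, R x y → y ∉ O))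
  amalgamation : ∀ X Y x q r, Sub X → Sub Y → (∀ r, Sp r Y ⊆ ⋃ s, Sp s X) → x ∈ Sp q X →
    x ∈ Sp r Y → ∃ Z, Sub Z ∧ (∀ i < q, Z i = X i) ∧
    (∀ r, Sp r Z ⊆ ⋃ s, Sp s X) ∧ ∀ r, ∀ z ∈ Sp r Z, R x z → z ∈ ⋃ s, Sp s Y

namespace RamseySystem

variable {B W P : Type*} (S : RamseySystem B W P)

/-! ### Refinement, finite approximations and boxes -/

/-- `Y` refines `X`. -/
def Le (Y X : ℕ → B) : Prop := ∀ r, S.Sp r Y ⊆ ⋃ s, S.Sp s X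

/-- `Y` is a subspace that refines `X` and has the same first `q` blocks. -/
structure LeAt (q : ℕ) (Y X : ℕ → B) : Prop where
  sub : S.Sub Y
  eq : ∀ i < q, Y i = X i
  le : S.Le Y X

/-- The list of the first `n + 1` terms of a sequence, the last one first. -/
def initial (x : ℕ → W) : ℕ → List W
  | 0 => [x 0]
  | n + 1 => x (n + 1) :: initial x n

/-- The points of the subspace `X`. -/
def points (X : ℕ → B) : Set P := {A | ∀ n, S.val A n ∈ ⋃ s, S.Sp s X}

/-- The points of the subspace `X` that start with the approximation `a`. -/
def box (a : List W) (X : ℕ → B) : Set P :=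
  {A | (∃ n, initial (S.val A) n = a) ∧ A ∈ S.points X}

/-- `a` is a finite approximation in `X` whose last word uses the first `q` blocks. -/
structure Approx (q : ℕ) (a : List W) (X : ℕ → B) : Prop where
  sub : S.Sub X
  shape : ∃ x l, a = x :: l ∧ x ∈ S.Sp q X ∧ l.length ≤ q ∧ ∀ z ∈ l, ∃ r ≤ q, z ∈ S.Sp r X

/-- The set `E` can be decided at every approximation. -/
def Ramsey (E : Set P) : Prop := ∀ q a X, S.Approx q a X →
  ∃ Y, S.LeAt q Y X ∧ (S.box a Y ⊆ E ∨ S.box a Y ⊆ Eᶜ)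

variable {S}

@[simp] theorem initial_length (x : ℕ → W) (n : ℕ) : (initial x n).length = n + 1 := by
  induction n with
  | zero => rfl
  | succ n ih => simp [initial, ih]

theorem initial_eq_iff {x y : ℕ → W} {n : ℕ} :
    initial x n = initial y n ↔ ∀ i ≤ n, x i = y i := by
  induction n with
  | zero => simp [initial]
  | succ n ih =>
    simp only [initial, List.cons.injEq, ih]
    constructor
    · rintro ⟨h, h'⟩ i hi
      rcases Nat.lt_or_ge n i with h1 | h1
      · obtain rfl : i = n + 1 := by omega
        exact h
      · exact h' i h1
    · intro h
      exact ⟨h _ le_rfl, fun i hi => h i (by omega)⟩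

theorem Le.refl (X : ℕ → B) : S.Le X X := fun r _ hx => Set.mem_iUnion.2 ⟨r, hx⟩

theorem Le.trans {X Y Z : ℕ → B} (h : S.Le Z Y) (h' : S.Le Y X) : S.Le Z X := by
  intro r x hx
  obtain ⟨s, hs⟩ := Set.mem_iUnion.1 (h r hx)
  exact h' s hs

theorem LeAt.refl {X : ℕ → B} (h : S.Sub X) (q : ℕ) : S.LeAt q X X :=
  ⟨h, fun _ _ => rfl, Le.refl X⟩

theorem LeAt.trans {q r : ℕ} {X Y Z : ℕ → B} (h : S.LeAt r Z Y) (h' : S.LeAt q Y X)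
    (hqr : q ≤ r) : S.LeAt q Z X :=
  ⟨h.sub, fun i hi => (h.eq i (by omega)).trans (h'.eq i hi), h.le.trans h'.le⟩

theorem LeAt.mono {q r : ℕ} {X Y : ℕ → B} (h : S.LeAt r Y X) (hqr : q ≤ r) : S.LeAt q Y X :=
  ⟨h.sub, fun i hi => h.eq i (by omega), h.le⟩

theorem Le.points_subset {X Y : ℕ → B} (h : S.Le Y X) : S.points Y ⊆ S.points X := by
  intro A hA n
  obtain ⟨s, hs⟩ := Set.mem_iUnion.1 (hA n)
  exact h s hs

theorem Le.box_subset {X Y : ℕ → B} (h : S.Le Y X) (a : List W) : S.box a Y ⊆ S.box a X :=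
  fun _ hA => ⟨hA.1, h.points_subset hA.2⟩

theorem Approx.congr {q : ℕ} {a : List W} {X Y : ℕ → B} (h : S.Approx q a X) (hY : S.Sub Y)
    (e : ∀ i < q, Y i = X i) : S.Approx q a Y := by
  obtain ⟨x, l, rfl, hx, hl, hz⟩ := h.shape
  refine ⟨hY, x, l, rfl, by rwa [S.sp_congr q Y X e], hl, fun z hzl => ?_⟩
  obtain ⟨r, hr, hzr⟩ := hz z hzl
  exact ⟨r, hr, by rwa [S.sp_congr r Y X fun i hi => e i (by omega)]⟩

theorem Approx.of_leAt {q : ℕ} {a : List W} {X Y : ℕ → B} (h : S.Approx q a X)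
    (hY : S.LeAt q Y X) : S.Approx q a Y := h.congr hY.sub hY.eq

theorem Approx.cons {q r : ℕ} {x y : W} {l : List W} {X : ℕ → B} (h : S.Approx q (x :: l) X)
    (hy : y ∈ S.Sp r X) (hR : S.R x y) : S.Approx r (y :: x :: l) X := by
  obtain ⟨x', l', e, hx, hl, hz⟩ := h.shape
  obtain ⟨rfl, rfl⟩ := List.cons.inj e
  have hqr := S.depth_lt X x y q r h.sub hx hy hR
  refine ⟨h.sub, y, x :: l, rfl, hy, by simp; omega, fun z hzl => ?_⟩
  rcases List.mem_cons.1 hzl with rfl | hzl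
  · exact ⟨q, hqr.le, hx⟩
  · obtain ⟨s, hs, h'⟩ := hz z hzl
    exact ⟨s, by omega, h'⟩

theorem exists_initial_eq_cons (x : ℕ → W) (n : ℕ) : ∃ l, initial x n = x n :: l := by
  cases n with
  | zero => exact ⟨[], rfl⟩
  | succ n => exact ⟨_, rfl⟩

/-- Each word uses strictly more blocks than its predecessor (`depth_lt`), so long approximations
are deep. This lets a fusion treat the `k`-th requirement only from depth `k` on. -/
theorem exists_approx {X : ℕ → B} (hX : S.Sub X) {A : P} (hA : A ∈ S.points X) (n : ℕ) :
    ∃ q, n ≤ q ∧ S.Approx q (initial (S.val A) n) X := by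
  induction n with
  | zero =>
    obtain ⟨s, hs⟩ := Set.mem_iUnion.1 (hA 0)
    exact ⟨s, Nat.zero_le _, hX, _, [], rfl, hs, by simp, by simp⟩
  | succ n ih =>
    obtain ⟨q, hq, h⟩ := ih
    obtain ⟨s, hs⟩ := Set.mem_iUnion.1 (hA (n + 1))
    obtain ⟨l, hl⟩ := exists_initial_eq_cons (S.val A) n
    rw [hl] at h
    have h' := h.cons hs (S.rel_val A n)
    refine ⟨s, ?_, by rw [initial, hl]; exact h'⟩
    obtain ⟨x', l', e, hx, -, -⟩ := h.shape
    obtain ⟨rfl, rfl⟩ := List.cons.inj e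
    have := S.depth_lt X _ _ q s hX hx hs (S.rel_val A n)
    omega

theorem finite_lists {F : Set W} (hF : F.Finite) (n : ℕ) :
    {l : List W | l.length ≤ n ∧ ∀ z ∈ l, z ∈ F}.Finite := by
  induction n with
  | zero =>
    refine (Set.finite_singleton ([] : List W)).subset ?_
    rintro l ⟨h, -⟩
    simpa using h
  | succ n ih =>
    refine ((Set.finite_singleton ([] : List W)).union
      (Set.Finite.image2 List.cons hF ih)).subset ?_
    rintro (_ | ⟨x, l⟩) ⟨h, h'⟩
    · simp
    · right
      refine ⟨x, h' x (by simp), l, ⟨by simpa using h, fun z hz => h' z (by simp [hz])⟩, rfl⟩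

/-- The length bound in `Approx` is there for this finiteness, which leaves each fusion stage with
finitely many approximations. -/
theorem finite_approx {X : ℕ → B} (hX : S.Sub X) (q : ℕ) : {a | S.Approx q a X}.Finite := by
  have hF : (⋃ r ∈ Set.Iic q, S.Sp r X).Finite :=
    (Set.finite_Iic q).biUnion fun r _ => S.sp_finite r X hX
  refine (finite_lists hF (q + 1)).subset ?_
  rintro a ⟨-, x, l, rfl, hx, hl, hz⟩
  refine ⟨by simpa using hl, fun z hzl => ?_⟩
  rw [Set.mem_iUnion₂]
  rcases List.mem_cons.1 hzl with rfl | hzl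
  · exact ⟨q, Set.mem_Iic.2 le_rfl, hx⟩
  · obtain ⟨r, hr, h⟩ := hz z hzl
    exact ⟨r, hr, h⟩

/-! ### Fusion and amalgamation -/

theorem exists_leAt_forall_finite {ι : Type*} {I : Set ι} (hI : I.Finite) {q : ℕ}
    (Q : ι → (ℕ → B) → Prop) {X : ℕ → B} (hX : S.Sub X)
    (hered : ∀ i ∈ I, ∀ X' Y, S.LeAt q X' X → S.LeAt q Y X' → Q i X' → Q i Y)
    (dense : ∀ i ∈ I, ∀ X', S.LeAt q X' X → ∃ Y, S.LeAt q Y X' ∧ Q i Y) :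
    ∃ Y, S.LeAt q Y X ∧ ∀ i ∈ I, Q i Y := by
  induction I, hI using Set.Finite.induction_on with
  | empty => exact ⟨X, LeAt.refl hX q, by simp⟩
  | @insert i I hi hI ih =>
    obtain ⟨Y, hY, hQ⟩ := ih (fun j hj => hered j (Set.mem_insert_of_mem _ hj))
      (fun j hj => dense j (Set.mem_insert_of_mem _ hj))
    obtain ⟨Z, hZ, hQZ⟩ := dense i (Set.mem_insert _ _) Y hY
    refine ⟨Z, hZ.trans hY le_rfl, fun j hj => ?_⟩
    rcases Set.mem_insert_iff.1 hj with rfl | hj'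
    · exact hQZ
    · exact hered j hj _ _ hY hZ (hQ j hj')

/-- Stage `j` treats the approximations of depth `q₀ + j` and freezes the first `q₀ + j` blocks.
Approximations of that depth see no other blocks, so they are the same in the limit, and heredity of
`Q` passes the decisions on. -/
theorem fusion (Q : ℕ → List W → (ℕ → B) → Prop) {X : ℕ → B} (hX : S.Sub X) (q₀ : ℕ)
    (hered : ∀ q a X Y, S.Approx q a X → S.LeAt q Y X → Q q a X → Q q a Y)
    (dense : ∀ q a X', S.LeAt q₀ X' X → S.Approx q a X' → ∃ Y, S.LeAt q Y X' ∧ Q q a Y) :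
    ∃ Y, S.LeAt q₀ Y X ∧ ∀ q, q₀ ≤ q → ∀ a, S.Approx q a Y → Q q a Y := by
  have step : ∀ q X', q₀ ≤ q → S.LeAt q₀ X' X →
      ∃ Y, S.LeAt q Y X' ∧ ∀ a, S.Approx q a X' → Q q a Y := fun q X' hq hX' =>
    exists_leAt_forall_finite (finite_approx hX'.sub q) (Q q) hX'.sub
      (fun a ha X₁ Y h₁ hY h => hered q a X₁ Y (Approx.of_leAt ha h₁) hY h)
      (fun a ha X₁ h₁ => dense q a X₁ (h₁.trans hX' hq) (Approx.of_leAt ha h₁))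
  choose! F hF hFQ using step
  let Z : ℕ → ℕ → B := fun j => Nat.rec X (fun j Z => F (q₀ + j) Z) j
  have hZX : ∀ j, S.LeAt q₀ (Z j) X := by
    intro j
    induction j with
    | zero => exact LeAt.refl hX _
    | succ j ih => exact (hF (q₀ + j) (Z j) (by omega) ih).trans ih (by omega)
  have hZs : ∀ j, S.LeAt (q₀ + j) (Z (j + 1)) (Z j) := fun j => hF _ _ (by omega) (hZX j)
  have hZm : ∀ j k, S.LeAt (q₀ + j) (Z (j + k)) (Z j) := by
    intro j k
    induction k with
    | zero => exact LeAt.refl (hZX j).sub _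
    | succ k ih => exact ((hZs (j + k)).mono (by omega)).trans ih le_rfl
  -- Since `i < q₀ + (i + 1)`, block `i` no longer changes from stage `i + 1` on.
  let Y : ℕ → B := fun i => Z (i + 1) i
  have hYe : ∀ j, ∀ i < q₀ + j, Y i = Z j i := by
    intro j i hi
    rcases Nat.le_total j (i + 1) with h | h
    · obtain ⟨k, hk⟩ := Nat.exists_eq_add_of_le h
      change Z (i + 1) i = _
      rw [hk]
      exact (hZm j k).eq i hi
    · obtain ⟨k, rfl⟩ := Nat.exists_eq_add_of_le h
      exact ((hZm (i + 1) k).eq i (by omega)).symm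
  have hYs : S.Sub Y := S.sub_of_local Y fun n =>
    ⟨Z n, (hZX n).sub, fun i hi => (hYe n i (by omega)).symm⟩
  have hYl : ∀ j, S.LeAt (q₀ + j) Y (Z j) := by
    refine fun j => ⟨hYs, hYe j, fun r x hx => ?_⟩
    -- A word of depth `r` only sees blocks on which the limit agrees with `Z (j + r)`, a refinement
    -- of `Z j`.
    rw [S.sp_congr r Y (Z (j + r)) fun i hi => hYe _ i (by omega)] at hx
    exact (hZm j r).le r hx
  refine ⟨Y, hYl 0, fun q hq a ha => ?_⟩
  obtain ⟨j, rfl⟩ := Nat.exists_eq_add_of_le hq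
  have haZ : S.Approx (q₀ + j) a (Z j) := ha.congr (hZX j).sub fun i hi => (hYe j i hi).symm
  exact hered _ a (Z (j + 1)) Y (haZ.of_leAt (hZs j)) ((hYl (j + 1)).mono (by omega))
    (hFQ _ _ (by omega) (hZX j) a haZ)

theorem mem_initial (x : ℕ → W) {i n : ℕ} (h : i ≤ n) : x i ∈ initial x n := by
  induction n with
  | zero =>
    obtain rfl : i = 0 := by omega
    simp [initial]
  | succ n ih =>
    rcases Nat.lt_or_ge n i with h1 | h1
    · obtain rfl : i = n + 1 := by omega
      simp [initial]
    · simp [initial, ih h1]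

theorem Approx.mem {q : ℕ} {a : List W} {X : ℕ → B} (h : S.Approx q a X) {z : W} (hz : z ∈ a) :
    z ∈ ⋃ s, S.Sp s X := by
  obtain ⟨x, l, rfl, hx, -, hl⟩ := h.shape
  rcases List.mem_cons.1 hz with rfl | hz
  · exact Set.mem_iUnion.2 ⟨q, hx⟩
  · obtain ⟨r, -, h'⟩ := hl z hz
    exact Set.mem_iUnion.2 ⟨r, h'⟩

theorem rel_of_lt (A : P) {m n : ℕ} (h : m < n) : S.R (S.val A m) (S.val A n) := by
  induction n with
  | zero => omega
  | succ n ih =>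
    rcases Nat.lt_or_ge m n with h1 | h1
    · exact S.rel_trans _ _ _ (ih h1) (S.rel_val A n)
    · obtain rfl : m = n := by omega
      exact S.rel_val A m

/-- Amalgamate at the last word of `a`: words of a point after it lie in `Y` by the choice of `Z`,
and those up to it belong to `a`, hence lie in `Y` anyway. -/
theorem exists_leAt_box_subset {q r : ℕ} {a : List W} {X Y : ℕ → B} (hX : S.Approx q a X)
    (hY : S.Approx r a Y) (h : S.Le Y X) : ∃ Z, S.LeAt q Z X ∧ S.box a Z ⊆ S.box a Y := by
  obtain ⟨x, l, rfl, hx, -, -⟩ := hX.shape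
  obtain ⟨x', l', e, hx', -, -⟩ := hY.shape
  obtain ⟨rfl, rfl⟩ := List.cons.inj e
  obtain ⟨Z, hZ, e, hle, hZY⟩ := S.amalgamation X Y x q r hX.sub hY.sub h hx hx'
  refine ⟨Z, ⟨hZ, e, hle⟩, ?_⟩
  rintro A ⟨⟨n, hn⟩, hA⟩
  refine ⟨⟨n, hn⟩, fun m => ?_⟩
  rcases Nat.lt_or_ge n m with h1 | h1
  · obtain ⟨l', hl'⟩ := exists_initial_eq_cons (S.val A) n
    obtain ⟨rfl, -⟩ := List.cons.inj (hn.symm.trans hl')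
    obtain ⟨s, hs⟩ := Set.mem_iUnion.1 (hA m)
    exact hZY s _ hs (rel_of_lt A h1)
  · exact hY.mem (hn ▸ mem_initial _ h1)

theorem box_initial {X : ℕ → B} {A : P} (hA : A ∈ S.points X) (n : ℕ) :
    A ∈ S.box (initial (S.val A) n) X := ⟨⟨n, rfl⟩, hA⟩

theorem box_initial_subset {X : ℕ → B} {A A' : P} {m n : ℕ} (h : m ≤ n)
    (hA : A' ∈ S.box (initial (S.val A) n) X) : A' ∈ S.box (initial (S.val A) m) X := by
  obtain ⟨⟨k, hk⟩, hA⟩ := hA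
  have hkn : k = n := by simpa using congrArg List.length hk
  subst hkn
  exact ⟨⟨m, initial_eq_iff.2 fun i hi => initial_eq_iff.1 hk i (by omega)⟩, hA⟩

theorem box_subset_of_mem {X Y : ℕ → B} {a : List W} {A : P} {n : ℕ} (hA : A ∈ S.box a X)
    (hn : a.length ≤ n + 1) : S.box (initial (S.val A) n) Y ⊆ S.box a Y := by
  obtain ⟨⟨m, rfl⟩, hA⟩ := hA
  exact fun A' hA' => box_initial_subset (by simpa using hn) hA'

/-! ### Accepting, rejecting, and open sets -/

/-- No refinement of `X` that contains the approximation `a` has its box at `a` inside `E`. -/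
def Rejects (S : RamseySystem B W P) (E : Set P) (a : List W) (X : ℕ → B) : Prop :=
  ∀ Y r, S.Approx r a Y → S.Le Y X → ¬ S.box a Y ⊆ E

theorem Rejects.mono {E : Set P} {a : List W} {X Y : ℕ → B} (h : S.Rejects E a X)
    (hY : S.Le Y X) : S.Rejects E a Y := fun Z r hZ hle => h Z r hZ (hle.trans hY)

/-- A refinement witnessing that `a` is not rejected may have changed the first `q` blocks;
amalgamation restores them without losing the inclusion in `E`. -/
theorem exists_accepts_or_rejects (E : Set P) {q : ℕ} {a : List W} {X : ℕ → B}
    (h : S.Approx q a X) : ∃ Y, S.LeAt q Y X ∧ (S.box a Y ⊆ E ∨ S.Rejects E a Y) := by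
  by_cases hr : S.Rejects E a X
  · exact ⟨X, LeAt.refl h.sub q, Or.inr hr⟩
  · simp only [Rejects, not_forall, not_not] at hr
    obtain ⟨Y, r, hY, hle, hE⟩ := hr
    obtain ⟨Z, hZ, hZY⟩ := exists_leAt_box_subset h hY hle
    exact ⟨Z, hZ, Or.inl (hZY.trans hE)⟩

/-- After a fusion every deeper approximation is accepted or rejected. The pigeonhole principle
makes this uniform over the one-word extensions of `x :: l`. If all are accepted, their boxes cover
the box of `x :: l`, which then cannot be rejected; so otherwise all are rejected. -/
theorem exists_accepts_or_rejects_cons (E : Set P) {q : ℕ} {x : W} {l : List W} {X : ℕ → B}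
    (h : S.Approx q (x :: l) X) : ∃ Y, S.LeAt q Y X ∧ (S.box (x :: l) Y ⊆ E ∨
      (S.Rejects E (x :: l) Y ∧ ∀ r, ∀ y ∈ S.Sp r Y, S.R x y → S.Rejects E (y :: x :: l) Y)) := by
  obtain ⟨Y, hY, hYd⟩ := fusion (S := S)
    (fun _ a Y => S.box a Y ⊆ E ∨ S.Rejects E a Y) h.sub q
    (fun q a X Y _ hY h => h.imp (fun h => (hY.le.box_subset a).trans h) (fun h => h.mono hY.le))
    (fun q a X' _ h => exists_accepts_or_rejects E h)
  have haY := h.of_leAt hY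
  rcases hYd q le_rfl _ haY with hacc | hrej
  · exact ⟨Y, hY, Or.inl hacc⟩
  obtain ⟨x', l', e, hx, -, -⟩ := haY.shape
  obtain ⟨rfl, rfl⟩ := List.cons.inj e
  obtain ⟨Z, hZ, e, hle, hO⟩ := S.pigeonhole Y x q {y | S.box (y :: x :: l) Y ⊆ E} hY.sub hx
  have hZY : S.LeAt q Z Y := ⟨hZ, e, hle⟩
  rcases hO with hO | hO
  · refine absurd ?_ (hrej Z q (haY.of_leAt hZY) hle)
    rintro A ⟨⟨n, hn⟩, hA⟩
    obtain ⟨l', hl'⟩ := exists_initial_eq_cons (S.val A) n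
    obtain ⟨rfl, rfl⟩ := List.cons.inj (hn.symm.trans hl')
    obtain ⟨s, hs⟩ := Set.mem_iUnion.1 (hA (n + 1))
    refine hO s _ hs (S.rel_val A n) ⟨⟨n + 1, ?_⟩, hZY.le.points_subset hA⟩
    rw [initial, hn]
  · refine ⟨Z, hZY.trans hY le_rfl, Or.inr ⟨hrej.mono hle, fun r y hy hR => ?_⟩⟩
    obtain ⟨r', hr'⟩ := Set.mem_iUnion.1 (hle r hy)
    exact ((hYd r' (S.depth_lt Y x y q r' hY.sub hx hr' hR).le _ (haY.cons hr' hR)).resolve_left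
      (hO r y hy hR)).mono hle

/-- A set that is open in the subspace `X` can be decided. -/
theorem exists_decides_of_open (E : Set P) {q : ℕ} {a : List W} {X : ℕ → B}
    (h : S.Approx q a X)
    (hE : ∀ A ∈ S.box a X, A ∈ E → ∃ n, a.length ≤ n + 1 ∧ S.box (initial (S.val A) n) X ⊆ E) :
    ∃ Y, S.LeAt q Y X ∧ (S.box a Y ⊆ E ∨ S.box a Y ⊆ Eᶜ) := by
  obtain ⟨Y, hY, hYd⟩ := fusion (S := S)
    (fun _ a Y => S.box a Y ⊆ E ∨ (S.Rejects E a Y ∧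
      ∀ x l, a = x :: l → ∀ r, ∀ y ∈ S.Sp r Y, S.R x y → S.Rejects E (y :: a) Y)) h.sub q
    (fun q a X Y _ hY h => h.imp (fun h => (hY.le.box_subset a).trans h) fun h =>
      ⟨h.1.mono hY.le, fun x l e r y hy hR => by
        obtain ⟨s, hs⟩ := Set.mem_iUnion.1 (hY.le r hy)
        exact (h.2 x l e s y hs hR).mono hY.le⟩)
    (fun q a X' _ h => by
      obtain ⟨x, l, rfl, -⟩ := h.shape
      obtain ⟨Y, hY, hd⟩ := exists_accepts_or_rejects_cons E h
      refine ⟨Y, hY, hd.imp_right fun h => ⟨h.1, ?_⟩⟩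
      rintro _ _ e
      obtain ⟨rfl, rfl⟩ := List.cons.inj e
      exact h.2)
  have haY := h.of_leAt hY
  rcases hYd q le_rfl _ haY with hacc | hrej
  · exact ⟨Y, hY, Or.inl hacc⟩
  refine ⟨Y, hY, Or.inr fun A hA hAE => ?_⟩
  -- Rejection of `a` propagates along all longer initial segments of `A`, whereas openness provides
  -- one that is accepted.
  have key : ∀ n, a.length ≤ n + 1 → S.Rejects E (initial (S.val A) n) Y ∧
      ∃ r, q ≤ r ∧ S.Approx r (initial (S.val A) n) Y := by
    intro n hn
    induction n with
    | zero =>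
      obtain ⟨⟨m, hm⟩, -⟩ := hA
      have : m = 0 := by
        have := congrArg List.length hm
        simp at this
        omega
      subst this
      rw [hm]
      exact ⟨hrej.1, q, le_rfl, haY⟩
    | succ n ih =>
      rcases Nat.lt_or_ge (n + 1) a.length with h1 | h1
      · obtain ⟨⟨m, hm⟩, -⟩ := hA
        have : m = n + 1 := by
          have := congrArg List.length hm
          simp at this
          omega
        subst this
        rw [hm]
        exact ⟨hrej.1, q, le_rfl, haY⟩
      · obtain ⟨hn1, r, hr, hap⟩ := ih h1
        obtain ⟨l, hl⟩ := exists_initial_eq_cons (S.val A) n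
        obtain ⟨s, hs⟩ := Set.mem_iUnion.1 (hA.2 (n + 1))
        refine ⟨?_, s, ?_, ?_⟩
        · rcases hYd r hr _ hap with h2 | h2
          · exact absurd h2 (hn1 Y r hap (Le.refl Y))
          · exact h2.2 _ l hl s _ hs (S.rel_val A n)
        · rw [hl] at hap
          obtain ⟨x', l', e, hx, -, -⟩ := hap.shape
          obtain ⟨rfl, rfl⟩ := List.cons.inj e
          exact hr.trans (S.depth_lt Y _ _ r s hY.sub hx hs (S.rel_val A n)).le
        · rw [initial, hl]
          exact (hl ▸ hap).cons hs (S.rel_val A n)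
  obtain ⟨n, hn, hsub⟩ := hE A (hY.le.box_subset a hA) hAE
  obtain ⟨h1, r, -, h2⟩ := key n hn
  exact h1 Y r h2 (Le.refl Y) ((hY.le.box_subset _).trans hsub)

/-! ### Closure properties of the Ramsey sets -/

theorem Ramsey.compl {E : Set P} (h : S.Ramsey E) : S.Ramsey Eᶜ := by
  intro q a X ha
  obtain ⟨Y, hY, hd⟩ := h q a X ha
  exact ⟨Y, hY, by rw [compl_compl]; exact hd.symm⟩

theorem Ramsey.of_open {E : Set P}
    (hE : ∀ A ∈ E, ∃ n, ∀ A', initial (S.val A') n = initial (S.val A) n → A' ∈ E) :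
    S.Ramsey E := by
  intro q a X ha
  refine exists_decides_of_open E ha fun A hA hAE => ?_
  obtain ⟨n, hn⟩ := hE A hAE
  refine ⟨max n a.length, by omega, fun A' hA' => ?_⟩
  obtain ⟨⟨k, hk⟩, -⟩ := box_initial_subset (le_max_left n a.length) hA'
  have hkn : k = n := by simpa using congrArg List.length hk
  subst hkn
  exact hn A' hk

/-- Fuse so that `E k` is decided at every approximation of depth at least `k`. A point of `E k`
then has an initial segment whose box lies in `E k`, so the union is open relative to the fused
subspace. -/
theorem Ramsey.iUnion {E : ℕ → Set P} (h : ∀ k, S.Ramsey (E k)) : S.Ramsey (⋃ k, E k) := by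
  intro q a X ha
  obtain ⟨Y, hY, hYd⟩ := fusion (S := S)
    (fun q a Y => ∀ k ∈ Set.Iic q, S.box a Y ⊆ E k ∨ S.box a Y ⊆ (E k)ᶜ) ha.sub q
    (fun q a X Y _ hY h k hk => (h k hk).imp (hY.le.box_subset a).trans (hY.le.box_subset a).trans)
    (fun q a X' _ h' => exists_leAt_forall_finite (Set.finite_Iic q)
      (fun k Y => S.box a Y ⊆ E k ∨ S.box a Y ⊆ (E k)ᶜ) h'.sub
      (fun k _ X₁ Y _ hY h => h.imp (hY.le.box_subset a).trans (hY.le.box_subset a).trans)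
      (fun k _ X₁ h₁ => h k q a X₁ (h'.of_leAt h₁)))
  obtain ⟨Z, hZ, hd⟩ := exists_decides_of_open (⋃ k, E k) (ha.of_leAt hY) (fun A hA hAE => by
    obtain ⟨k, hk⟩ := Set.mem_iUnion.1 hAE
    refine ⟨max (max k q) a.length, by omega, ?_⟩
    obtain ⟨r, hr, hap⟩ := exists_approx hY.sub hA.2 (max (max k q) a.length)
    rcases hYd r (by omega) _ hap k (Set.mem_Iic.2 (by omega)) with h1 | h1
    · exact h1.trans (Set.subset_iUnion E k)
    · exact absurd hk (h1 (box_initial hA.2 _)))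
  exact ⟨Z, hZ.trans hY le_rfl, hd⟩

theorem Ramsey.union {E F : Set P} (hE : S.Ramsey E) (hF : S.Ramsey F) : S.Ramsey (E ∪ F) := by
  have : E ∪ F = ⋃ k : ℕ, if k = 0 then E else F := by
    ext A
    simp only [Set.mem_union, Set.mem_iUnion]
    constructor
    · rintro (h | h)
      · exact ⟨0, by simpa using h⟩
      · exact ⟨1, by simpa using h⟩
    · rintro ⟨k, hk⟩
      by_cases h : k = 0
      · left; simpa [h] using hk
      · right; simpa [h] using hk
  rw [this]
  exact Ramsey.iUnion fun k => by split_ifs <;> assumption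

theorem Ramsey.inter {E F : Set P} (hE : S.Ramsey E) (hF : S.Ramsey F) : S.Ramsey (E ∩ F) := by
  have := (hE.compl.union hF.compl).compl
  rwa [Set.compl_union, compl_compl, compl_compl] at this

/-- A countable union of sets of which every box can be freed can be avoided. -/
theorem exists_avoids {I : Type*} [Encodable I] {N : I → Set P} {q : ℕ} {a : List W} {X : ℕ → B}
    (ha : S.Approx q a X)
    (hN : ∀ i r b X', S.Le X' X → S.Approx r b X' →
      ∃ Y, S.LeAt r Y X' ∧ S.box b Y ⊆ (N i)ᶜ) :
    ∃ Y, S.LeAt q Y X ∧ ∀ A ∈ S.points Y, ∀ i, A ∉ N i := by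
  have hfin : ∀ r, {i : I | Encodable.encode i ≤ r}.Finite := fun r =>
    Set.Finite.preimage (Encodable.encode_injective.injOn) (Set.finite_Iic r)
  obtain ⟨Y, hY, hYd⟩ := fusion (S := S)
    (fun r b Y => ∀ i ∈ {i : I | Encodable.encode i ≤ r}, S.box b Y ⊆ (N i)ᶜ) ha.sub q
    (fun q a X Y _ hY h i hi => (hY.le.box_subset a).trans (h i hi))
    (fun r b X' hX' h' => exists_leAt_forall_finite (hfin r)
      (fun i Y => S.box b Y ⊆ (N i)ᶜ) h'.sub
      (fun k _ X₁ Y _ hY h => (hY.le.box_subset b).trans h)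
      (fun i _ X₁ h₁ => hN i r b X₁ (h₁.le.trans hX'.le) (h'.of_leAt h₁)))
  refine ⟨Y, hY, fun A hA i => ?_⟩
  obtain ⟨r, hr, hap⟩ := exists_approx hY.sub hA (max q (Encodable.encode i))
  exact hYd r (by omega) _ hap i (show Encodable.encode i ≤ r by omega) (box_initial hA _)

/-- This is the envelope argument of Szpilrajn-Marczewski, with "every box can be freed" in the role
of "negligible". -/
theorem Ramsey.souslin {F : List ℕ → Set P} (hF : ∀ s, S.Ramsey (F s)) :
    S.Ramsey (⋃ σ : ℕ → ℕ, ⋂ n : ℕ, F ((List.range n).map σ)) := by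
  intro q a X ha
  -- The points with a branch through `s`. The family `F` need not be decreasing, so all initial
  -- segments of the branch are required.
  let E : List ℕ → Set P := fun s =>
    {A | ∃ σ : ℕ → ℕ, (List.range s.length).map σ = s ∧ ∀ n, A ∈ F ((List.range n).map σ)}
  have hE0 : (⋃ σ : ℕ → ℕ, ⋂ n : ℕ, F ((List.range n).map σ)) = E [] := by
    ext A
    simp [E]
  have hEs : ∀ s A, A ∈ E s → ∃ k, A ∈ E (s ++ [k]) := by
    rintro s A ⟨σ, hσ, h⟩
    refine ⟨σ s.length, σ, ?_, h⟩
    rw [List.length_append, List.length_singleton, List.range_succ, List.map_append, hσ]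
    rfl
  have hEF : ∀ s, E s ⊆ F s := by
    rintro s A ⟨σ, hσ, h⟩
    exact hσ ▸ h s.length
  have hfin : ∀ r, {s : List ℕ | Encodable.encode s ≤ r}.Finite := fun r =>
    Set.Finite.preimage (Encodable.encode_injective.injOn) (Set.finite_Iic r)
  obtain ⟨Y, hY, hYd⟩ := fusion (S := S)
    (fun r b Y => ∀ s ∈ {s : List ℕ | Encodable.encode s ≤ r},
      S.box b Y ⊆ (E s)ᶜ ∨ S.Rejects (E s)ᶜ b Y) ha.sub q
    (fun q a X Y _ hY h s hs =>
      (h s hs).imp (hY.le.box_subset a).trans fun h => h.mono hY.le)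
    (fun r b X' _ h' => exists_leAt_forall_finite (hfin r)
      (fun s Y => S.box b Y ⊆ (E s)ᶜ ∨ S.Rejects (E s)ᶜ b Y) h'.sub
      (fun k _ X₁ Y _ hY h => h.imp (hY.le.box_subset b).trans fun h => h.mono hY.le)
      (fun s _ X₁ h₁ => exists_accepts_or_rejects _ (h'.of_leAt h₁)))
  -- The envelope of `E s`: remove from `F s` the boxes of `Y` that miss `E s`. What is removed is
  -- open, so the envelope is Ramsey although `E s` is not known to be.
  let K : List ℕ → Set P := fun s =>
    {A | ∀ n, Encodable.encode s ≤ n → ¬ S.box (initial (S.val A) n) Y ⊆ (E s)ᶜ} ∩ F s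
  have hEK : ∀ s, E s ∩ S.points Y ⊆ K s := fun s A hA =>
    ⟨fun n _ h => h (box_initial hA.2 n) hA.1, hEF s hA.1⟩
  have hK : ∀ s, S.Ramsey (K s) := by
    refine fun s => Ramsey.inter ?_ (hF s)
    have : S.Ramsey {A | ∃ n, Encodable.encode s ≤ n ∧
        S.box (initial (S.val A) n) Y ⊆ (E s)ᶜ} := by
      refine Ramsey.of_open ?_
      rintro A ⟨n, hn, h⟩
      exact ⟨n, fun A' hA' => ⟨n, hn, by rwa [hA']⟩⟩
    convert this.compl using 1
    ext A
    simp
  let N : List ℕ → Set P := fun s => K s ∩ (⋃ k : ℕ, K (s ++ [k]))ᶜ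
  obtain ⟨Z, hZ, hZN⟩ := exists_avoids (N := N) (ha.of_leAt hY) (by
    intro s r b X' hX' hb
    obtain ⟨Z, hZ, hd⟩ := ((hK s).inter (Ramsey.iUnion fun k => hK (s ++ [k])).compl) r b X' hb
    -- A box inside `N s` misses `E s`, because within `Y` the set `E s` is covered by the envelopes
    -- of its successors. At a long initial segment of a point of this box, `Y` has been decided: a
    -- box missing `E s` would expel the point from `K s`, and rejection is refuted by `Z`.
    refine ⟨Z, hZ, hd.elim (fun hsub A hA _ => ?_) id⟩
    have hZY : S.Le Z Y := hZ.le.trans hX'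
    have hdisj : S.box b Z ⊆ (E s)ᶜ := by
      intro A' hA' hE
      obtain ⟨k, hk⟩ := hEs s A' hE
      exact (hsub hA').2 (Set.mem_iUnion.2 ⟨k, hEK _ ⟨hk, hZY.points_subset hA'.2⟩⟩)
    obtain ⟨r', hr', hap⟩ := exists_approx hZ.sub hA.2 (max q (max (Encodable.encode s) b.length))
    obtain ⟨r₂, hr₂, hap₂⟩ := exists_approx hY.sub (hZY.points_subset hA.2)
      (max q (max (Encodable.encode s) b.length))
    rcases hYd r₂ (by omega) _ hap₂ s (show Encodable.encode s ≤ r₂ by omega) with h1 | h1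
    · exact (hsub hA).1.1 _ (by omega) h1
    · exact h1 Z r' hap hZY ((box_subset_of_mem hA (by omega)).trans hdisj))
  obtain ⟨Z', hZ', hd⟩ := hK [] q a Z ((ha.of_leAt hY).of_leAt hZ)
  refine ⟨Z', (hZ'.trans hZ le_rfl).trans hY le_rfl, ?_⟩
  -- With all `N s` avoided, a point of an envelope always lies in the envelope of some successor;
  -- iterating traces a branch, and `K s ⊆ F s` makes it a witness.
  have hKE : K [] ∩ S.points Z ⊆ E [] := by
    rintro A ⟨hA, hAZ⟩
    have hs : ∀ s, A ∈ K s → ∃ k, A ∈ K (s ++ [k]) := by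
      intro s hs
      by_contra h
      exact hZN A hAZ s ⟨hs, fun h' => h (Set.mem_iUnion.1 h')⟩
    choose! g hg using hs
    let t : ℕ → List ℕ := fun n => Nat.rec [] (fun _ s => s ++ [g s]) n
    have ht : ∀ n, A ∈ K (t n) := by
      intro n
      induction n with
      | zero => exact hA
      | succ n ih => exact hg _ ih
    have htr : ∀ n, (List.range n).map (fun i => g (t i)) = t n := by
      intro n
      induction n with
      | zero => rfl
      | succ n ih =>
        rw [List.range_succ, List.map_append, ih]
        rfl
    exact ⟨fun i => g (t i), rfl, fun n => by rw [htr]; exact (ht n).2⟩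
  rw [hE0]
  refine hd.imp (fun h A hA => hKE ⟨h hA, hZ'.le.points_subset hA.2⟩) (fun h A hA hE => ?_)
  exact h hA (hEK [] ⟨hE, hZ.le.points_subset (hZ'.le.points_subset hA.2)⟩)

/-- All codes start with `e`, so the box of `[e]` is the whole subspace; decide the color classes
there one after the other. -/
theorem exists_le_decides_finite {C : Type*} [Finite C] (c : P → C)
    (hc : ∀ j, S.Ramsey (c ⁻¹' {j})) {e : W} (he : ∀ A, S.val A 0 = e) {X : ℕ → B}
    (hX : S.Sub X) (heX : e ∈ S.Sp 0 X) :
    ∃ Y, S.Sub Y ∧ S.Le Y X ∧ ∀ A ∈ S.points Y, ∀ A' ∈ S.points Y, c A = c A' := by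
  have ha : S.Approx 0 [e] X := ⟨hX, e, [], rfl, heX, by simp, by simp⟩
  obtain ⟨Y, hY, hd⟩ := exists_leAt_forall_finite (S := S) (Set.finite_univ (α := C)) (q := 0)
    (fun j Y => S.box [e] Y ⊆ c ⁻¹' {j} ∨ S.box [e] Y ⊆ (c ⁻¹' {j})ᶜ) hX
    (fun j _ X' Y _ hY h => h.imp (hY.le.box_subset _).trans (hY.le.box_subset _).trans)
    (fun j _ X' h' => hc j 0 [e] X' (ha.of_leAt h'))
  have hbox : ∀ A ∈ S.points Y, A ∈ S.box [e] Y := fun A hA => ⟨⟨0, by simp [initial, he A]⟩, hA⟩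
  refine ⟨Y, hY.sub, hY.le, fun A hA A' hA' => ?_⟩
  rcases hd (c A') (Set.mem_univ _) with h | h
  · exact h (hbox A hA)
  · exact absurd rfl (h (hbox A' hA'))

end RamseySystem
/-! ### Levels of a tree -/

section Tree

variable {S : Type*} [PartialOrder S]

theorem IsTree.level_lt (h : IsTree S) {t s : S} (hts : t < s) : level t < level s := by
  refine Set.ncard_lt_ncard ⟨Set.Iio_subset_Iio hts.le, fun hs => ?_⟩ (h.pred_finite s)
  exact lt_irrefl t (hs hts)

theorem IsTree.level_mono (h : IsTree S) {t s : S} (hts : t ≤ s) : level t ≤ level s :=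
  Set.ncard_le_ncard (Set.Iio_subset_Iio hts) (h.pred_finite s)

theorem IsTree.chain_Iic (h : IsTree S) (s : S) : IsChain (· ≤ ·) (Set.Iic s) := by
  intro u hu v hv huv
  rcases (Set.mem_Iic.1 hu).lt_or_eq with hu | rfl
  · rcases (Set.mem_Iic.1 hv).lt_or_eq with hv | rfl
    · exact h.pred_chain s hu hv huv
    · exact Or.inl hu.le
  · exact Or.inr hv

theorem IsTree.le_of_level_le (h : IsTree S) {t u s : S} (ht : t ≤ s) (hu : u ≤ s)
    (hl : level t ≤ level u) : t ≤ u := by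
  rcases (h.chain_Iic s).total ht hu with h1 | h1
  · exact h1
  · rcases h1.lt_or_eq with h2 | rfl
    · exact absurd (h.level_lt h2) (by omega)
    · exact le_rfl

theorem IsTree.eq_of_level_eq (h : IsTree S) {t u s : S} (ht : t ≤ s) (hu : u ≤ s)
    (hl : level t = level u) : t = u :=
  le_antisymm (h.le_of_level_le ht hu hl.le) (h.le_of_level_le hu ht hl.ge)

/-- On the chain `Set.Iic s` of `level s + 1` nodes, `level` is injective with values at most `level
s`, hence takes all of them. -/
theorem IsTree.exists_le_level_eq (h : IsTree S) {s : S} {m : ℕ} (hm : m ≤ level s) :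
    ∃ u ≤ s, level u = m := by
  have hfin : (Set.Iic s).Finite := by
    rw [← Set.Iio_insert]
    exact (h.pred_finite s).insert s
  have hcard : (Set.Iic s).ncard = level s + 1 := by
    rw [← Set.Iio_insert, Set.ncard_insert_of_notMem (by simp) (h.pred_finite s)]
    rfl
  have hinj : Set.InjOn (level (S := S)) (Set.Iic s) := fun u hu v hv e =>
    h.eq_of_level_eq hu hv e
  have himg : level '' Set.Iic s = Set.Iic (level s) := by
    refine Set.eq_of_subset_of_ncard_le ?_ ?_ (Set.finite_Iic _)
    · rintro _ ⟨u, hu, rfl⟩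
      exact h.level_mono hu
    · rw [hinj.ncard_image, hcard]
      simp [Set.ncard_eq_toFinset_card']
  have : m ∈ level '' Set.Iic s := by rw [himg]; exact hm
  obtain ⟨u, hu, e⟩ := this
  exact ⟨u, hu, e⟩

/-- The predecessors of a maximal node, together with the node, would be a finite maximal chain. -/
theorem IsTree.exists_gt (h : IsTree S) (hh : HasHeight S Cardinal.aleph0) (t : S) :
    ∃ s, t < s := by
  by_contra hno
  push Not at hno
  have hmax : IsMaxChain (· ≤ ·) (Set.Iic t) := by
    refine ⟨h.chain_Iic t, fun C hC hsub => hsub.antisymm fun c hc => ?_⟩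
    rcases hC.total hc (hsub (Set.mem_Iic.2 le_rfl)) with h1 | h1
    · exact h1
    · rcases h1.lt_or_eq with h2 | rfl
      · exact absurd h2 (hno c)
      · exact le_rfl
  have hfin : (Set.Iic t).Finite := by
    rw [← Set.Iio_insert]
    exact (h.pred_finite t).insert t
  have := hh _ hmax
  exact absurd this (Cardinal.lt_aleph0_iff_set_finite.2 hfin).ne

theorem IsTree.exists_ge_level_eq (h : IsTree S) (hh : HasHeight S Cardinal.aleph0) {t : S}
    {n : ℕ} (hn : level t ≤ n) : ∃ s, t ≤ s ∧ level s = n := by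
  have key : ∀ m, ∃ s, t ≤ s ∧ m ≤ level s := by
    intro m
    induction m with
    | zero => exact ⟨t, le_rfl, Nat.zero_le _⟩
    | succ m ih =>
      obtain ⟨s, hs, hm⟩ := ih
      obtain ⟨s', hs'⟩ := h.exists_gt hh s
      exact ⟨s', hs.trans hs'.le, by have := h.level_lt hs'; omega⟩
  obtain ⟨s, hs, hm⟩ := key n
  obtain ⟨u, hu, e⟩ := h.exists_le_level_eq hm
  exact ⟨u, h.le_of_level_le hs hu (by omega), e⟩

theorem IsTree.exists_level_eq (h : IsTree S) (hh : HasHeight S Cardinal.aleph0) (n : ℕ) :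
    ∃ s : S, level s = n := by
  obtain ⟨r, hr⟩ := h.exists_root
  have h0 : level r = 0 := by
    have : Set.Iio r = ∅ := by
      ext u
      simp only [Set.mem_Iio, Set.mem_empty_iff_false, iff_false]
      exact fun hu => absurd (hr u) hu.not_ge
    rw [level, this, Set.ncard_empty]
  obtain ⟨s, -, hs⟩ := h.exists_ge_level_eq hh (t := r) (n := n) (by omega)
  exact ⟨s, hs⟩

theorem IsTree.finite_level (h : IsTree S) (n : ℕ) : {t : S | level t = n}.Finite := by
  induction n with
  | zero =>
    obtain ⟨r, hr⟩ := h.exists_root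
    refine (Set.finite_singleton r).subset fun t ht => ?_
    have ht : level t = 0 := ht
    rcases (hr t).lt_or_eq with h1 | h1
    · have := h.level_lt h1
      omega
    · exact h1.symm
  | succ n ih =>
    refine (ih.biUnion fun u _ => h.imsuc_finite u).subset fun t ht => ?_
    have ht : level t = n + 1 := ht
    obtain ⟨u, hu, e⟩ := h.exists_le_level_eq (s := t) (m := n) (by omega)
    rw [Set.mem_iUnion₂]
    refine ⟨u, e, lt_of_le_of_ne hu ?_, fun v h1 h2 => ?_⟩
    · rintro rfl
      omega
    · have := h.level_lt h1
      have := h.level_lt h2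
      omega

end Tree

/-! ### Levels of a level product -/

section Product

variable {d : ℕ} {T : Fin d → Type*} [∀ i, PartialOrder (T i)]

/-- The level of a node of the level product. -/
noncomputable def plevel (t : LevelProduct T) : ℕ := t.2.choose

theorem mem_prodLevel_plevel (t : LevelProduct T) : t ∈ prodLevel (plevel t) := t.2.choose_spec

/-- For `d = 0` the only tuple lies in every level, and the chosen `plevel` would be arbitrary. -/
theorem mem_prodLevel_iff [NeZero d] {t : LevelProduct T} {n : ℕ} :
    t ∈ prodLevel n ↔ plevel t = n :=
  ⟨fun h => (mem_prodLevel_plevel t 0).symm.trans (h 0), fun h => h ▸ mem_prodLevel_plevel t⟩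

theorem level_eq_plevel (t : LevelProduct T) (i : Fin d) : level (t.1 i) = plevel t :=
  mem_prodLevel_plevel t i

theorem mem_slab_iff [NeZero d] {t : LevelProduct T} {m n : ℕ} :
    t ∈ slab T m n ↔ m ≤ plevel t ∧ plevel t < n := by
  simp only [slab, Set.mem_ofPred_eq, mem_prodLevel_iff]
  constructor
  · rintro ⟨k, h1, h2, rfl⟩
    exact ⟨h1, h2⟩
  · rintro ⟨h1, h2⟩
    exact ⟨_, h1, h2, rfl⟩

theorem plevel_mono [NeZero d] (hT : ∀ i, IsTree (T i)) {t s : LevelProduct T} (h : t ≤ s) :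
    plevel t ≤ plevel s := by
  rw [← level_eq_plevel t 0, ← level_eq_plevel s 0]
  exact (hT 0).level_mono (h 0)

theorem exists_plevel_eq [NeZero d] (hT : ∀ i, IsTree (T i))
    (hh : ∀ i, HasHeight (T i) Cardinal.aleph0) (n : ℕ) :
    ∃ t : LevelProduct T, plevel t = n := by
  choose s hs using fun i => (hT i).exists_level_eq (hh i) n
  exact ⟨⟨s, n, hs⟩, mem_prodLevel_iff.1 hs⟩

theorem finite_prodLevel (hT : ∀ i, IsTree (T i)) (n : ℕ) :
    (prodLevel n : Set (LevelProduct T)).Finite := by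
  have : (Set.univ.pi fun i => {t : T i | level t = n}).Finite :=
    Set.Finite.pi fun i => (hT i).finite_level n
  refine Set.Finite.of_finite_image (f := Subtype.val) (this.subset ?_) (by simp)
  rintro _ ⟨t, ht, rfl⟩ i _
  exact ht i

theorem finite_slab (hT : ∀ i, IsTree (T i)) (m n : ℕ) : (slab T m n).Finite := by
  refine ((Set.finite_Iio n).biUnion fun k _ => finite_prodLevel hT k).subset ?_
  rintro t ⟨k, -, h2, h3⟩
  exact Set.mem_iUnion₂.2 ⟨k, h2, h3⟩

theorem Dominates.mono {S : Type*} [PartialOrder S] (h : IsTree S)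
    (hh : HasHeight S Cardinal.aleph0) {D : Set S} {m n : ℕ} (hmn : m ≤ n)
    (hD : Dominates D {t | level t = n}) : Dominates D {t | level t = m} := by
  intro t ht
  obtain ⟨s, hs, e⟩ := h.exists_ge_level_eq hh (t := t) (n := n) (by rw [ht]; exact hmn)
  obtain ⟨u, hu, h'⟩ := hD s e
  exact ⟨u, hu, hs.trans h'⟩

end Product

/-! ### Words as partial functions -/

section Words

variable {Λ : Type*} {d : ℕ} {T : Fin d → Type*} [∀ i, PartialOrder (T i)]

theorem PWord.mem_dom {f : PWord Λ T} {t : LevelProduct T} : t ∈ f.dom ↔ f t ≠ none := Iff.rfl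

theorem PWord.notMem_dom {f : PWord Λ T} {t : LevelProduct T} : t ∉ f.dom ↔ f t = none := by
  rw [PWord.mem_dom, not_not]

theorem PWord.union_apply (f g : PWord Λ T) (t : LevelProduct T) :
    f.union g t = (f t).or (g t) := rfl

theorem PWord.union_apply_of_mem {f g : PWord Λ T} {t : LevelProduct T} (h : t ∈ f.dom) :
    f.union g t = f t := by
  rw [PWord.union_apply, Option.or_of_isSome (Option.isSome_iff_ne_none.2 h)]

theorem PWord.union_apply_of_notMem {f g : PWord Λ T} {t : LevelProduct T} (h : t ∉ f.dom) :
    f.union g t = g t := by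
  rw [PWord.union_apply, PWord.notMem_dom.1 h, Option.none_or]

theorem PWord.union_assoc (f g h : PWord Λ T) : (f.union g).union h = f.union (g.union h) :=
  funext fun _ => Option.or_assoc

theorem PWord.dom_union (f g : PWord Λ T) : (f.union g).dom = f.dom ∪ g.dom := by
  ext t
  by_cases h : t ∈ f.dom
  · simp [h, PWord.mem_dom, PWord.union_apply_of_mem h, PWord.mem_dom.1 h]
  · simp [h, PWord.mem_dom, PWord.union_apply_of_notMem h]

theorem PWord.dom_empty : (PWord.empty : PWord Λ T).dom = ∅ := by
  ext t
  simp [PWord.mem_dom, PWord.empty]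

theorem PWord.dom_subst (f : PWord Λ T) (a : LevelProduct T → Λ) : (f.subst a).dom = f.dom := by
  ext t
  simp [PWord.mem_dom, PWord.subst]

theorem PWord.subst_union (f g : PWord Λ T) (a : LevelProduct T → Λ) :
    (f.union g).subst a = (f.subst a).union (g.subst a) := by
  funext t
  simp only [PWord.subst, PWord.union]
  cases f t <;> simp

theorem PWord.union_eq_left {f g : PWord Λ T} (h : g.dom ⊆ f.dom) : f.union g = f := by
  funext t
  by_cases ht : t ∈ f.dom
  · exact PWord.union_apply_of_mem ht
  · rw [PWord.union_apply_of_notMem ht, PWord.notMem_dom.1 ht,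
      PWord.notMem_dom.1 fun h' => ht (h h')]

theorem PWord.unionUpTo_congr {g h : ℕ → PWord Λ T} {q : ℕ} (e : ∀ i < q, g i = h i) :
    PWord.unionUpTo g q = PWord.unionUpTo h q := by
  induction q with
  | zero => rfl
  | succ q ih =>
    rw [PWord.unionUpTo, PWord.unionUpTo, ih fun i hi => e i (by omega), e q (by omega)]

theorem PWord.subst_unionUpTo (g : ℕ → PWord Λ T) (a : LevelProduct T → Λ) (q : ℕ) :
    (PWord.unionUpTo g q).subst a = PWord.unionUpTo (fun i => (g i).subst a) q := by
  induction q with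
  | zero => rfl
  | succ q ih => rw [PWord.unionUpTo, PWord.subst_union, ih, PWord.unionUpTo]

/-- The word `g` properly extends the word `f`. -/
def Extends (f g : PWord Λ T) : Prop := (∀ t ∈ f.dom, g t = f t) ∧ f ≠ g

theorem Extends.trans {f g h : PWord Λ T} (h₁ : Extends f g) (h₂ : Extends g h) :
    Extends f h := by
  have hd : f.dom ⊆ g.dom := fun t ht => by
    rw [PWord.mem_dom, h₁.1 t ht]
    exact ht
  refine ⟨fun t ht => (h₂.1 t (hd ht)).trans (h₁.1 t ht), ?_⟩
  rintro rfl
  refine h₁.2 (funext fun t => ?_)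
  by_cases ht : t ∈ g.dom
  · exact h₂.1 t ht
  · rw [PWord.notMem_dom.1 ht, PWord.notMem_dom.1 fun h' => ht (hd h')]

theorem eq_of_extends_of_dom_subset {f g : PWord Λ T} (h : ∀ t ∈ f.dom, g t = f t)
    (hd : g.dom ⊆ f.dom) : f = g := by
  funext t
  by_cases ht : t ∈ f.dom
  · exact (h t ht).symm
  · rw [PWord.notMem_dom.1 ht, PWord.notMem_dom.1 fun h' => ht (hd h')]

/-! ### Bottoms and tops -/

section Slab

variable [NeZero d]

theorem slab_union {l m n : ℕ} (h₁ : l ≤ m) (h₂ : m ≤ n) :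
    slab T l m ∪ slab T m n = slab T l n := by
  ext t
  simp only [Set.mem_union, mem_slab_iff]
  omega

theorem slab_eq_empty {m n : ℕ} (h : n ≤ m) : slab T m n = ∅ := by
  ext t
  simp only [mem_slab_iff, Set.mem_empty_iff_false, iff_false]
  omega

variable (hT : ∀ i, IsTree (T i)) (hh : ∀ i, HasHeight (T i) Cardinal.aleph0)
include hT hh

theorem bot_of_dom_eq {f : PWord Λ T} {m n : ℕ} (hf : f.dom = slab T m n) (h : m < n) :
    f.bot = m := by
  obtain ⟨t, ht⟩ := exists_plevel_eq hT hh m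
  refine IsLeast.csInf_eq ⟨⟨t, mem_prodLevel_iff.2 ht, ?_⟩, ?_⟩
  · rw [hf, mem_slab_iff]
    omega
  · rintro k ⟨s, hs, hs'⟩
    rw [mem_prodLevel_iff] at hs
    rw [hf, mem_slab_iff] at hs'
    omega

theorem top_of_dom_eq {f : PWord Λ T} {m n : ℕ} (hf : f.dom = slab T m n) (h : m < n) :
    f.top = n := by
  obtain ⟨t, ht⟩ := exists_plevel_eq hT hh (n - 1)
  refine IsLeast.csInf_eq ⟨?_, ?_⟩
  · change f.dom ⊆ slab T 0 n
    intro s hs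
    rw [hf, mem_slab_iff] at hs
    rw [mem_slab_iff]
    omega
  · intro k hk
    have hk : f.dom ⊆ slab T 0 k := hk
    have : t ∈ slab T 0 k := hk (by rw [hf, mem_slab_iff]; omega)
    rw [mem_slab_iff] at this
    omega

theorem ne_empty_of_dom_eq {f : PWord Λ T} {m n : ℕ} (hf : f.dom = slab T m n) (h : m < n) :
    f ≠ PWord.empty := by
  rintro rfl
  obtain ⟨t, ht⟩ := exists_plevel_eq hT hh m
  have : t ∈ slab T m n := by
    rw [mem_slab_iff]
    omega
  rw [← hf, PWord.dom_empty] at this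
  exact this

theorem top_bot_of_dom_eq_of_ne_empty {f : PWord Λ T} {m n : ℕ} (hf : f.dom = slab T m n)
    (h : f ≠ PWord.empty) : m < n ∧ f.bot = m ∧ f.top = n := by
  have hmn : m < n := by
    by_contra hmn
    rw [slab_eq_empty (by omega)] at hf
    exact h (funext fun t => PWord.notMem_dom.1 (by rw [hf]; simp))
  exact ⟨hmn, bot_of_dom_eq hT hh hf hmn, top_of_dom_eq hT hh hf hmn⟩

theorem slab_zero_subset_iff {m n : ℕ} : slab T 0 m ⊆ slab T 0 n ↔ m ≤ n := by
  constructor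
  · intro h
    by_contra hmn
    obtain ⟨t, ht⟩ := exists_plevel_eq hT hh n
    have := h (mem_slab_iff.2 ⟨Nat.zero_le _, show plevel t < m by omega⟩)
    rw [mem_slab_iff] at this
    omega
  · intro h t
    simp only [mem_slab_iff]
    omega

end Slab

/-! ### Subspaces -/

/-- Data that witness that `X` is a subspace: the boundaries, the levels of the variables and the
sets of variables. -/
structure Frame (X : ℕ → PWord Λ T) where
  N : ℕ → ℕ
  k : ℕ → ℕ
  D : ℕ → ∀ j, Set (T j)
  zero : N 0 = 0
  le : ∀ i, N i ≤ k i
  lt : ∀ i, k i < N (i + 1)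
  vlevel : ∀ i, IsVectorLevelSubset (D i) (k i)
  varWord : ∀ i, X i ∈ varWords (D i) (N i) (N (i + 1))
  dominates : ∀ i j, Dominates (D i j) {t : T j | level t = i}

theorem Frame.strictMono {X : ℕ → PWord Λ T} (F : Frame X) : StrictMono F.N :=
  strictMono_nat_of_lt_succ fun i => (F.le i).trans_lt (F.lt i)

theorem Frame.dom {X : ℕ → PWord Λ T} (F : Frame X) (i : ℕ) :
    (X i).dom = slab T (F.N i) (F.N (i + 1)) := (F.varWord i).1

section

variable [NeZero d] (hT : ∀ i, IsTree (T i)) (hh : ∀ i, HasHeight (T i) Cardinal.aleph0)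
include hT hh

theorem Frame.isSubspace {X : ℕ → PWord Λ T} (F : Frame X) : IsSubspace X := by
  have hlt : ∀ i, F.N i < F.N (i + 1) := fun i => F.strictMono (Nat.lt_succ_self i)
  refine ⟨fun i => Or.inr (Or.inr ?_), fun i => ⟨F.D i, ⟨F.k i, F.N i, F.N (i + 1), F.vlevel i,
    F.le i, F.lt i, F.varWord i⟩, F.dominates i⟩, ?_⟩
  · rw [top_of_dom_eq hT hh (F.dom i) (hlt i), bot_of_dom_eq hT hh (F.dom (i + 1)) (hlt _)]
  · rw [bot_of_dom_eq hT hh (F.dom 0) (hlt 0), F.zero]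

theorem IsSubspace.nonempty_frame {X : ℕ → PWord Λ T} (h : IsSubspace X) : Nonempty (Frame X) := by
  choose D hD hdom using h.varWord
  choose k m n hk hmk hkn hX using hD
  have hd : ∀ i, (X i).dom = slab T (m i) (n i) := fun i => (hX i).1
  have hlt : ∀ i, m i < n i := fun i => (hmk i).trans_lt (hkn i)
  have hb : ∀ i, (X i).bot = m i := fun i => bot_of_dom_eq hT hh (hd i) (hlt i)
  have ht : ∀ i, (X i).top = n i := fun i => top_of_dom_eq hT hh (hd i) (hlt i)
  have hmn : ∀ i, n i = m (i + 1) := by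
    intro i
    rcases h.compatible i with h1 | h1 | h1
    · exact absurd h1 (ne_empty_of_dom_eq hT hh (hd i) (hlt i))
    · exact absurd h1 (ne_empty_of_dom_eq hT hh (hd _) (hlt _))
    · rw [← ht, ← hb, h1]
  exact ⟨⟨m, k, D, by rw [← hb, h.bot_eq], hmk, fun i => by rw [← hmn]; exact hkn i, hk,
    fun i => by rw [← hmn]; exact hX i, hdom⟩⟩

end

/-- The words that are spanned by the first `q` blocks of `X`. -/
def spanUpTo (q : ℕ) (X : ℕ → PWord Λ T) : Set (PWord Λ T) :=
  {w | ∃ g : ℕ → PWord Λ T, (∀ i < q, g i ∈ (X i).span) ∧ w = PWord.unionUpTo g q}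

/-- The span of `X`, including the empty word. -/
def fullSpan (X : ℕ → PWord Λ T) : Set (PWord Λ T) := ⋃ q, spanUpTo q X

theorem seqSpan_eq (X : ℕ → PWord Λ T) : seqSpan X = ⋃ q, spanUpTo (q + 1) X := by
  ext w
  simp only [seqSpan, Set.mem_ofPred_eq, Set.mem_iUnion]
  constructor
  · rintro ⟨q, hq, h⟩
    obtain ⟨r, rfl⟩ := Nat.exists_eq_add_of_le' hq
    exact ⟨r, h⟩
  · rintro ⟨q, h⟩
    exact ⟨q + 1, by omega, h⟩

theorem empty_mem_spanUpTo (X : ℕ → PWord Λ T) : PWord.empty ∈ spanUpTo 0 X :=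
  ⟨fun _ => PWord.empty, by simp, rfl⟩

theorem eq_empty_of_mem_spanUpTo_zero {X : ℕ → PWord Λ T} {x : PWord Λ T}
    (h : x ∈ spanUpTo 0 X) : x = PWord.empty := by
  obtain ⟨g, -, rfl⟩ := h
  rfl

theorem spanUpTo_congr {q : ℕ} {X Y : ℕ → PWord Λ T} (h : ∀ i < q, X i = Y i) :
    spanUpTo q X = spanUpTo q Y := by
  ext w
  constructor
  · rintro ⟨g, hg, rfl⟩
    exact ⟨g, fun i hi => h i hi ▸ hg i hi, rfl⟩
  · rintro ⟨g, hg, rfl⟩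
    exact ⟨g, fun i hi => (h i hi).symm ▸ hg i hi, rfl⟩

theorem subst_unionUpTo_mem_spanUpTo (X : ℕ → PWord Λ T) (q : ℕ) (a : LevelProduct T → Λ) :
    (PWord.unionUpTo X q).subst a ∈ spanUpTo q X :=
  ⟨fun i => (X i).subst a, fun _ _ => ⟨a, rfl⟩, PWord.subst_unionUpTo X a q⟩

theorem mem_spanUpTo_succ {X : ℕ → PWord Λ T} {q : ℕ} {w : PWord Λ T} :
    w ∈ spanUpTo (q + 1) X ↔ ∃ h ∈ spanUpTo q X, ∃ a, w = h.union ((X q).subst a) := by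
  constructor
  · rintro ⟨g, hg, rfl⟩
    obtain ⟨a, ha⟩ := hg q (by omega)
    exact ⟨_, ⟨g, fun i hi => hg i (by omega), rfl⟩, a, by rw [ha]; rfl⟩
  · rintro ⟨_, ⟨g, hg, rfl⟩, a, rfl⟩
    refine ⟨Function.update g q ((X q).subst a), fun i hi => ?_, ?_⟩
    · by_cases h : i = q
      · subst h
        rw [Function.update_self]
        exact ⟨a, rfl⟩
      · rw [Function.update_of_ne h]
        exact hg i (by omega)
    · rw [PWord.unionUpTo, Function.update_self, PWord.unionUpTo_congr fun i hi => ?_]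
      rw [Function.update_of_ne (by omega)]

theorem unionUpTo_mem_varFree {X : ℕ → PWord Λ T} {q : ℕ} {w : PWord Λ T}
    (h : w ∈ spanUpTo q X) {t : LevelProduct T} {y} (ht : w t = some y) :
    ∃ a : Λ, y = Sum.inl a := by
  induction q generalizing w with
  | zero =>
    obtain rfl := eq_empty_of_mem_spanUpTo_zero h
    simp [PWord.empty] at ht
  | succ q ih =>
    obtain ⟨w, hw, a, rfl⟩ := mem_spanUpTo_succ.1 h
    by_cases hd : t ∈ w.dom
    · rw [PWord.union_apply_of_mem hd] at ht
      exact ih hw ht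
    · rw [PWord.union_apply_of_notMem hd, PWord.subst] at ht
      rcases hX : X q t with _ | (b | s) <;> rw [hX] at ht
      · simp at ht
      · exact ⟨b, by simpa using ht.symm⟩
      · exact ⟨a s, by simpa using ht.symm⟩

namespace Frame

variable [NeZero d] {X : ℕ → PWord Λ T}

theorem dom_unionUpTo (F : Frame X) {g : ℕ → PWord Λ T} {q : ℕ}
    (hg : ∀ i < q, (g i).dom = (X i).dom) : (PWord.unionUpTo g q).dom = slab T 0 (F.N q) := by
  induction q with
  | zero =>
    rw [PWord.unionUpTo, PWord.dom_empty, F.zero, slab_eq_empty le_rfl]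
  | succ q ih =>
    rw [PWord.unionUpTo, PWord.dom_union, ih fun i hi => hg i (by omega), hg q (by omega), F.dom,
      slab_union (Nat.zero_le _) (F.strictMono.monotone (Nat.le_succ q))]

theorem dom_of_mem_spanUpTo (F : Frame X) {q : ℕ} {w : PWord Λ T} (h : w ∈ spanUpTo q X) :
    w.dom = slab T 0 (F.N q) := by
  obtain ⟨g, hg, rfl⟩ := h
  refine F.dom_unionUpTo fun i hi => ?_
  obtain ⟨a, ha⟩ := hg i hi
  rw [← ha, PWord.dom_subst]

/-- Since `w` takes precedence, the union replaces the first `q` blocks of `z` by those of `w`. This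
makes the span a semigroup. -/
theorem union_mem_spanUpTo (F : Frame X) {q r : ℕ} {w z : PWord Λ T} (hw : w ∈ spanUpTo q X)
    (hz : z ∈ spanUpTo r X) : w.union z ∈ spanUpTo (max q r) X := by
  have key : ∀ r z, q ≤ r → z ∈ spanUpTo r X → w.union z ∈ spanUpTo r X := by
    intro r z hqr
    induction r, hqr using Nat.le_induction generalizing z with
    | base =>
      intro hz
      rwa [PWord.union_eq_left (by rw [F.dom_of_mem_spanUpTo hz, F.dom_of_mem_spanUpTo hw])]
    | succ r _ ih =>
      intro hz
      obtain ⟨z', hz', a, rfl⟩ := mem_spanUpTo_succ.1 hz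
      rw [← PWord.union_assoc]
      exact mem_spanUpTo_succ.2 ⟨_, ih z' hz', a, rfl⟩
  rcases Nat.le_total q r with h | h
  · rw [max_eq_right h]
    exact key r z h hz
  · rw [max_eq_left h, PWord.union_eq_left]
    · exact hw
    · rw [F.dom_of_mem_spanUpTo hz, F.dom_of_mem_spanUpTo hw]
      intro t
      simp only [mem_slab_iff]
      have := F.strictMono.monotone h
      omega

theorem union_mem_fullSpan (F : Frame X) {w z : PWord Λ T} (hw : w ∈ fullSpan X)
    (hz : z ∈ fullSpan X) : w.union z ∈ fullSpan X := by
  obtain ⟨q, hq⟩ := Set.mem_iUnion.1 hw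
  obtain ⟨r, hr⟩ := Set.mem_iUnion.1 hz
  exact Set.mem_iUnion.2 ⟨_, F.union_mem_spanUpTo hq hr⟩

theorem lt_of_extends (hT : ∀ i, IsTree (T i)) (hh : ∀ i, HasHeight (T i) Cardinal.aleph0)
    (F : Frame X) {q r : ℕ} {x y : PWord Λ T} (hx : x ∈ spanUpTo q X) (hy : y ∈ spanUpTo r X)
    (h : Extends x y) : q < r := by
  by_contra hqr
  refine h.2 (eq_of_extends_of_dom_subset h.1 ?_)
  rw [F.dom_of_mem_spanUpTo hx, F.dom_of_mem_spanUpTo hy, slab_zero_subset_iff hT hh]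
  exact F.strictMono.monotone (by omega)

theorem finite_spanUpTo [Finite Λ] (hT : ∀ i, IsTree (T i)) (F : Frame X) (q : ℕ) :
    (spanUpTo q X).Finite := by
  classical
  have hs := finite_slab hT 0 (F.N q)
  have := hs.to_subtype
  let φ : PWord Λ T → (slab T 0 (F.N q) → Option Λ) := fun w t =>
    (w t).elim none (Sum.elim some fun _ => none)
  refine Set.Finite.of_finite_image (f := φ) (Set.toFinite _) ?_
  intro x hx y hy e
  have key : ∀ {x}, x ∈ spanUpTo q X → ∀ (t : LevelProduct T) (ht : t ∈ slab T 0 (F.N q)),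
      x t = (φ x ⟨t, ht⟩).map Sum.inl := by
    intro x hx t ht
    rw [← F.dom_of_mem_spanUpTo hx] at ht
    obtain ⟨y, hy⟩ := Option.ne_none_iff_exists'.1 ht
    obtain ⟨a, rfl⟩ := unionUpTo_mem_varFree hx hy
    simp [φ, hy]
  funext t
  by_cases ht : t ∈ slab T 0 (F.N q)
  · rw [key hx t ht, key hy t ht, e]
  · have h1 := ht
    rw [← F.dom_of_mem_spanUpTo hx] at h1
    rw [← F.dom_of_mem_spanUpTo hy] at ht
    rw [PWord.notMem_dom.1 h1, PWord.notMem_dom.1 ht]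

end Frame

end Words

/-! ### Monochromatic variable words -/

section Probes

variable {Λ : Type*} {d : ℕ} {T : Fin d → Type*} [∀ i, PartialOrder (T i)]

theorem PWord.exists_of_unionUpTo {g : ℕ → PWord Λ T} {q : ℕ} {t : LevelProduct T} {y}
    (h : PWord.unionUpTo g q t = some y) : ∃ i < q, g i t = some y := by
  induction q with
  | zero => simp [PWord.unionUpTo, PWord.empty] at h
  | succ q ih =>
    rw [PWord.unionUpTo] at h
    by_cases ht : t ∈ (PWord.unionUpTo g q).dom
    · rw [PWord.union_apply_of_mem ht] at h
      obtain ⟨i, hi, e⟩ := ih h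
      exact ⟨i, by omega, e⟩
    · rw [PWord.union_apply_of_notMem ht] at h
      exact ⟨q, by omega, h⟩

theorem IsVectorLevelSubset.level_eq {D : ∀ i, Set (T i)} {k : ℕ} (h : IsVectorLevelSubset D k)
    {i : Fin d} {t : T i} (ht : t ∈ D i) : level t = k := by
  have : level t ∈ levelSet (D i) := ⟨t, ht, rfl⟩
  rwa [h i] at this

theorem IsVectorLevelSubset.plevel_eq [NeZero d] {D : ∀ i, Set (T i)} {k : ℕ}
    (h : IsVectorLevelSubset D k) {t : LevelProduct T} (ht : t ∈ subProduct D) : plevel t = k := by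
  rw [← level_eq_plevel t 0]
  exact h.level_eq (ht 0)

theorem Frame.strictMono_k {X : ℕ → PWord Λ T} (F : Frame X) : StrictMono F.k :=
  strictMono_nat_of_lt_succ fun i => (F.lt i).trans_le (F.le (i + 1))

theorem Frame.le_k {X : ℕ → PWord Λ T} (F : Frame X) (i : ℕ) : i ≤ F.k i := F.strictMono_k.le_apply

theorem Frame.unionUpTo_apply [NeZero d] {X : ℕ → PWord Λ T} (F : Frame X) {i q : ℕ} (hi : i < q)
    {t : LevelProduct T} (ht : t ∈ (X i).dom) : PWord.unionUpTo X q t = X i t := by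
  obtain ⟨y, hy⟩ : ∃ y, PWord.unionUpTo X q t = some y := by
    refine Option.ne_none_iff_exists'.1 (PWord.mem_dom.1 ?_)
    rw [F.dom_unionUpTo fun _ _ => rfl]
    rw [F.dom, mem_slab_iff] at ht
    rw [mem_slab_iff]
    have := F.strictMono.monotone (show i + 1 ≤ q from hi)
    omega
  obtain ⟨j, hj, e⟩ := PWord.exists_of_unionUpTo hy
  have htj : t ∈ (X j).dom := by simp [PWord.mem_dom, e]
  rw [F.dom, mem_slab_iff] at ht htj
  have hij : i = j := by
    rcases lt_trichotomy i j with h | h | h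
    · have := F.strictMono.monotone (show i + 1 ≤ j from h)
      omega
    · exact h
    · have := F.strictMono.monotone (show j + 1 ≤ i from h)
      omega
  rw [hy, hij, e]

theorem Frame.unionUpTo_eq_inr_iff [NeZero d] {X : ℕ → PWord Λ T} (F : Frame X) {i q : ℕ}
    (hi : i < q) {s t : LevelProduct T} (hs : s ∈ subProduct (F.D i)) :
    PWord.unionUpTo X q t = some (Sum.inr s) ↔ X i t = some (Sum.inr s) := by
  constructor
  · intro h
    obtain ⟨j, hj, e⟩ := PWord.exists_of_unionUpTo h
    have h1 := (F.vlevel j).plevel_eq ((F.varWord j).2.1 t s e)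
    have h2 := (F.vlevel i).plevel_eq hs
    obtain rfl := F.strictMono_k.injective (h2.symm.trans h1)
    exact e
  · intro h
    rw [F.unionUpTo_apply hi (by simp [PWord.mem_dom, h]), h]

/-- A variable word that starts at level `0`, whose substitution instances lie in the span of `X`,
and whose variables have level at least `n` and dominate level `n`. -/
def IsProbe (X : ℕ → PWord Λ T) (n : ℕ) (f : PWord Λ T) : Prop :=
  ∃ (D : ∀ j, Set (T j)) (k N : ℕ), IsVectorLevelSubset D k ∧ n ≤ k ∧ k < N ∧
    f ∈ varWords D 0 N ∧ (∀ j, Dominates (D j) {t : T j | level t = n}) ∧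
    ∀ a, f.subst a ∈ fullSpan X

/-- Successive choices of nodes in the variable sets of `X` above the nodes of level `n`. -/
theorem Frame.exists_towers [NeZero d] (hT : ∀ i, IsTree (T i))
    (hh : ∀ i, HasHeight (T i) Cardinal.aleph0) {X : ℕ → PWord Λ T} (F : Frame X) (n : ℕ) :
    ∃ (I : ℕ → ℕ) (s : ℕ → ∀ c, {t : T c // level t = n} → T c), StrictMono I ∧ n ≤ I 0 ∧
      (∀ j c t, s j c t ∈ F.D (I j) c) ∧ (∀ j c t, t.1 ≤ s j c t) ∧
      ∀ i j, i ≤ j → ∀ c t, s i c t ≤ s j c t := by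
  -- Nodes chosen in block `I j` have level `F.k (I j)`. The next index exceeds this, so they extend
  -- to level `I (j + 1)`, which the variables of block `I (j + 1)` dominate.
  let I : ℕ → ℕ := fun j => Nat.rec n (fun _ i => F.k i + 1) j
  have hI : StrictMono I := strictMono_nat_of_lt_succ fun j => by
    change I j < F.k (I j) + 1
    have := F.le_k (I j)
    omega
  have step : ∀ j (s : ∀ c, {t : T c // level t = n} → T c), (∀ c t, s c t ∈ F.D (I j) c) →
      ∃ s' : ∀ c, {t : T c // level t = n} → T c, (∀ c t, s' c t ∈ F.D (I (j + 1)) c) ∧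
        ∀ c t, s c t ≤ s' c t := by
    intro j s hs
    have : ∀ c t, ∃ u ∈ F.D (I (j + 1)) c, s c t ≤ u := by
      intro c t
      have hl := (F.vlevel (I j)).level_eq (hs c t)
      obtain ⟨v, hv, e⟩ := (hT c).exists_ge_level_eq (hh c) (t := s c t) (n := I (j + 1))
        (by rw [hl]; exact Nat.le_succ _)
      obtain ⟨u, hu, h'⟩ := F.dominates (I (j + 1)) c v e
      exact ⟨u, hu, hv.trans h'⟩
    choose s' h1 h2 using this
    exact ⟨s', h1, h2⟩
  have h0 : ∀ c (t : {t : T c // level t = n}), ∃ u ∈ F.D (I 0) c, t.1 ≤ u := fun c t =>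
    F.dominates n c t.1 t.2
  choose s₀ hs₀ hle₀ using h0
  choose! G hG hGle using step
  let s : ℕ → ∀ c, {t : T c // level t = n} → T c := fun j => Nat.rec s₀ (fun j s => G j s) j
  have hs : ∀ j c t, s j c t ∈ F.D (I j) c := by
    intro j
    induction j with
    | zero => exact hs₀
    | succ j ih => exact hG j _ ih
  have hmono : ∀ i j, i ≤ j → ∀ c t, s i c t ≤ s j c t := by
    intro i j hij c t
    induction j, hij using Nat.le_induction with
    | base => exact le_rfl
    | succ j _ ih => exact ih.trans (hGle j _ (hs j) c t)
  exact ⟨I, s, hI, le_rfl, hs, fun j c t => (hle₀ c t).trans (hmono 0 j (Nat.zero_le _) c t),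
    hmono⟩

/-- A combinatorial line becomes a variable word: for each `τ` of level `n`, the variables above `τ`
in the blocks of the active coordinates are identified, and all other variables are replaced by
letters. One letter of the Hales–Jewett alphabet fixes the values for all `τ` at once, so the
instances are exactly indexed by points of the line. -/
theorem Frame.exists_mono_probe [NeZero d] [Finite Λ] [Nonempty Λ] (hT : ∀ i, IsTree (T i))
    (hh : ∀ i, HasHeight (T i) Cardinal.aleph0) {X : ℕ → PWord Λ T} (F : Frame X) (n : ℕ)
    {κ : Type*} [Finite κ] (c : PWord Λ T → κ) :
    ∃ f, IsProbe X n f ∧ ∃ j, ∀ a, c (f.subst a) = j := by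
  classical
  obtain ⟨I, s, hI, hnI, hsD, hles, hsmono⟩ := F.exists_towers hT hh n
  have := (finite_prodLevel hT n).to_subtype
  obtain ⟨ι, _, hHJ⟩ := Combinatorics.Line.exists_mono_in_high_dimension
    (↥(prodLevel n : Set (LevelProduct T)) → Λ) κ
  let e := Fintype.equivFin ι
  let r := I (Fintype.card ι)
  have hr : ∀ i : ι, I (e i) < r := fun i => hI (e i).2
  let σ : ι × (prodLevel n : Set (LevelProduct T)) → LevelProduct T := fun p =>
    ⟨fun j => s (e p.1) j ⟨p.2.1.1 j, p.2.2 j⟩, F.k (I (e p.1)), fun j =>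
      (F.vlevel _).level_eq (hsD _ j _)⟩
  have hσD : ∀ p, σ p ∈ subProduct (F.D (I (e p.1))) := fun p j => hsD _ j _
  have hσle : ∀ i i' τ, e i ≤ e i' → σ (i, τ) ≤ σ (i', τ) := fun i i' τ h j => hsmono _ _ h j _
  -- The level of the node recovers the coordinate, and its predecessors at level `n` recover `τ`.
  have hσ : Function.Injective σ := by
    rintro ⟨i, τ⟩ ⟨i', τ'⟩ h
    have h1 := (F.vlevel _).plevel_eq (hσD (i, τ))
    have h2 := (F.vlevel _).plevel_eq (hσD (i', τ'))
    rw [h, h2] at h1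
    have h3 := e.injective (Fin.ext (hI.injective (F.strictMono_k.injective h1)))
    simp only at h3
    subst h3
    refine Prod.ext rfl (Subtype.ext (Subtype.ext (funext fun j => ?_)))
    have h4 : s (e i') j ⟨τ.1.1 j, τ.2 j⟩ = s (e i') j ⟨τ'.1.1 j, τ'.2 j⟩ :=
      congrFun (congrArg Subtype.val h) j
    exact (hT j).eq_of_level_eq (hles (e i') j ⟨τ.1.1 j, τ.2 j⟩)
      (h4 ▸ hles (e i') j ⟨τ'.1.1 j, τ'.2 j⟩) ((τ.2 j).trans (τ'.2 j).symm)
  let inv := Function.partialInv σ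
  have hinv : ∀ p, inv (σ p) = some p := fun p => Function.partialInv_left hσ p
  have hinv' : ∀ {p x}, inv x = some p → σ p = x := fun {p x} h =>
    (Function.Injective.isPartialInv hσ p x).1 h
  let l₀ : Λ := Classical.arbitrary Λ
  let A : (ι → ↥(prodLevel n : Set (LevelProduct T)) → Λ) → LevelProduct T → Λ := fun w x =>
    (inv x).elim l₀ fun p => w p.1 p.2
  obtain ⟨l, j, hl⟩ := hHJ fun w => c ((PWord.unionUpTo X r).subst (A w))
  -- The lowest active coordinate names the variables: towers increase, so occurrences from other
  -- active blocks lie above its nodes, as the minimum condition demands.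
  obtain ⟨i₀, hi₀, hmin⟩ : ∃ i₀, l.idxFun i₀ = none ∧ ∀ i, l.idxFun i = none → e i₀ ≤ e i := by
    obtain ⟨i₁, hi₁⟩ := l.proper
    obtain ⟨i₀, h, h'⟩ := Set.exists_min_image {i | l.idxFun i = none} e (Set.toFinite _) ⟨i₁, hi₁⟩
    exact ⟨i₀, h, h'⟩
  let ψ : LevelProduct T → Λ ⊕ LevelProduct T := fun x =>
    (inv x).elim (Sum.inl l₀) fun p =>
      (l.idxFun p.1).elim (Sum.inr (σ (i₀, p.2))) fun w => Sum.inl (w p.2)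
  have hψ : ∀ {x y}, ψ x = Sum.inr y → ∃ i τ, l.idxFun i = none ∧ x = σ (i, τ) ∧
      y = σ (i₀, τ) := by
    intro x y h
    rcases hx : inv x with _ | ⟨i, τ⟩
    · simp [ψ, hx] at h
    · rcases hi : l.idxFun i with _ | w
      · refine ⟨i, τ, hi, (hinv' hx).symm, ?_⟩
        simpa [ψ, hx, hi] using h.symm
      · simp [ψ, hx, hi] at h
  let Z := PWord.unionUpTo X r
  let f : PWord Λ T := fun t => (Z t).map (Sum.elim Sum.inl ψ)
  have hZdom : Z.dom = slab T 0 (F.N r) := F.dom_unionUpTo fun _ _ => rfl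
  have hfdom : f.dom = slab T 0 (F.N r) := by
    rw [← hZdom]
    ext t
    change (Z t).map _ ≠ none ↔ Z t ≠ none
    simp
  have hfocc : ∀ τ t, f t = some (Sum.inr (σ (i₀, τ))) ↔
      ∃ i, l.idxFun i = none ∧ X (I (e i)) t = some (Sum.inr (σ (i, τ))) := by
    intro τ t
    constructor
    · intro h
      rcases hZ : Z t with _ | (b | x)
      · simp [f, hZ] at h
      · simp [f, hZ] at h
      · have h : ψ x = Sum.inr (σ (i₀, τ)) := by simpa [f, hZ] using h
        obtain ⟨i, τ', hi, rfl, h3⟩ := hψ h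
        obtain rfl := (Prod.mk.inj (hσ h3)).2
        exact ⟨i, hi, (F.unionUpTo_eq_inr_iff (hr i) (hσD (i, τ))).1 hZ⟩
    · rintro ⟨i, hi, h⟩
      have hZ : Z t = _ := (F.unionUpTo_eq_inr_iff (hr i) (hσD (i, τ))).2 h
      simp [f, hZ, ψ, hinv, hi]
  let D : ∀ j, Set (T j) := fun j => Set.range (s (e i₀) j)
  have hD : ∀ x, x ∈ subProduct D → ∃ τ, x = σ (i₀, τ) := by
    intro x hx
    choose u hu using hx
    refine ⟨⟨⟨fun j => (u j).1, n, fun j => (u j).2⟩, fun j => (u j).2⟩, ?_⟩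
    exact Subtype.ext (funext fun j => (hu j).symm)
  have hD' : ∀ τ, σ (i₀, τ) ∈ subProduct D := fun τ j => ⟨_, rfl⟩
  refine ⟨f, ⟨D, F.k (I (e i₀)), F.N r, ?_, ?_, ?_, ⟨hfdom, ?_, ?_, ?_⟩, ?_, ?_⟩, j, ?_⟩
  · intro j
    ext m
    simp only [levelSet, Set.mem_image, Set.mem_singleton_iff]
    constructor
    · rintro ⟨_, ⟨u, rfl⟩, rfl⟩
      exact (F.vlevel _).level_eq (hsD _ _ _)
    · rintro rfl
      obtain ⟨t, ht⟩ := (hT j).exists_level_eq (hh j) n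
      exact ⟨s (e i₀) j ⟨t, ht⟩, ⟨_, rfl⟩, (F.vlevel _).level_eq (hsD _ _ _)⟩
  · exact hnI.trans ((hI.monotone (Nat.zero_le _)).trans (F.le_k _))
  · exact (F.lt _).trans_le (F.strictMono.monotone (hr i₀))
  · intro t x h
    rcases hZ : Z t with _ | (b | y)
    · simp [f, hZ] at h
    · simp [f, hZ] at h
    · have h : ψ y = Sum.inr x := by simpa [f, hZ] using h
      obtain ⟨i, τ, -, -, rfl⟩ := hψ h
      exact hD' τ
  · intro x hx
    obtain ⟨τ, rfl⟩ := hD x hx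
    constructor
    · exact (hfocc τ _).2 ⟨i₀, hi₀, ((F.varWord _).2.2.1 _ (hσD (i₀, τ))).1⟩
    · intro t ht
      obtain ⟨i, hi, h⟩ := (hfocc τ t).1 ht
      exact (hσle i₀ i τ (hmin i hi)).trans (((F.varWord _).2.2.1 _ (hσD (i, τ))).2 h)
  · have key : ∀ τ τ', prodLevelSet (f.occ (σ (i₀, τ))) ⊆ prodLevelSet (f.occ (σ (i₀, τ'))) := by
      rintro τ τ' m ⟨t, htm, ht⟩
      obtain ⟨i, hi, h⟩ := (hfocc τ t).1 ht
      have h1 : m ∈ prodLevelSet ((X (I (e i))).occ (σ (i, τ))) := ⟨t, htm, h⟩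
      rw [(F.varWord _).2.2.2 _ (hσD (i, τ)) _ (hσD (i, τ'))] at h1
      obtain ⟨t', htm', h'⟩ := h1
      exact ⟨t', htm', (hfocc τ' t').2 ⟨i, hi, h'⟩⟩
    intro x hx x' hx'
    obtain ⟨τ, rfl⟩ := hD x hx
    obtain ⟨τ', rfl⟩ := hD x' hx'
    exact (key τ τ').antisymm (key τ' τ)
  · exact fun j t ht => ⟨s (e i₀) j ⟨t, ht⟩, ⟨_, rfl⟩, hles _ j ⟨t, ht⟩⟩
  all_goals
    -- An instance of `f` is the instance of `Z` given by the point of the line at the letter `τ ↦ a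
    -- (σ (i₀, τ))`.
    have hsub : ∀ a, f.subst a = Z.subst (A (l fun τ => a (σ (i₀, τ)))) := by
      intro a
      funext t
      rcases hZ : Z t with _ | (b | x)
      · simp [PWord.subst, f, hZ]
      · simp [PWord.subst, f, hZ]
      · rcases hx : inv x with _ | ⟨i, τ⟩
        · simp [PWord.subst, f, hZ, ψ, A, hx]
        · rcases hi : l.idxFun i with _ | w
          · simp [PWord.subst, f, hZ, ψ, A, hx, hi]
          · simp [PWord.subst, f, hZ, ψ, A, hx, hi]
  · intro a
    rw [hsub]
    exact Set.mem_iUnion.2 ⟨r, subst_unionUpTo_mem_spanUpTo X r _⟩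
  · intro a
    rw [hsub]
    exact hl _

end Probes

/-! ### The pigeonhole principle and amalgamation -/

section Pigeonhole

variable {Λ : Type*} {d : ℕ} {T : Fin d → Type*} [∀ i, PartialOrder (T i)]

/-- The words form a semigroup under the union in which the first word takes precedence. -/
instance : Semigroup (PWord Λ T) where
  mul := PWord.union
  mul_assoc := PWord.union_assoc

theorem PWord.subst_eq_self {f : PWord Λ T}
    (h : ∀ t y, f t = some y → ∃ a : Λ, y = Sum.inl a) (a : LevelProduct T → Λ) :
    f.subst a = f := by
  funext t
  rcases ht : f t with _ | y
  · simp [PWord.subst, ht]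
  · obtain ⟨b, rfl⟩ := h t y ht
    simp [PWord.subst, ht]

theorem varFree_of_mem_fullSpan {X : ℕ → PWord Λ T} {w : PWord Λ T} (h : w ∈ fullSpan X) :
    ∀ t y, w t = some y → ∃ a : Λ, y = Sum.inl a := by
  obtain ⟨q, hq⟩ := Set.mem_iUnion.1 h
  exact fun t y => unionUpTo_mem_varFree hq

theorem IsProbe.mono {X : ℕ → PWord Λ T} {m n : ℕ} {f : PWord Λ T} (hT : ∀ i, IsTree (T i))
    (hh : ∀ i, HasHeight (T i) Cardinal.aleph0) (hmn : m ≤ n) (h : IsProbe X n f) :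
    IsProbe X m f := by
  obtain ⟨D, k, N, h1, h2, h3, h4, h5, h6⟩ := h
  exact ⟨D, k, N, h1, hmn.trans h2, h3, h4, fun j => (h5 j).mono (hT j) (hh j) hmn, h6⟩

/-- Changing a variable word only at levels below its variables, and in such a way that no
variables are added, yields a variable word. -/
theorem mem_varWords_of_occ_eq {D : ∀ j, Set (T j)} {m n m' n' : ℕ} {f g : PWord Λ T}
    (hf : f ∈ varWords D m n) (hg : g.dom = slab T m' n')
    (hv : ∀ t s, g t = some (Sum.inr s) → f t = some (Sum.inr s))
    (hv' : ∀ s ∈ subProduct D, ∀ t, f t = some (Sum.inr s) → g t = some (Sum.inr s)) :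
    g ∈ varWords D m' n' := by
  have hocc : ∀ s ∈ subProduct D, g.occ s = f.occ s := fun s hs =>
    Set.Subset.antisymm (fun t => hv t s) (fun t => hv' s hs t)
  refine ⟨hg, fun t s h => hf.2.1 t s (hv t s h), fun s hs => ?_, fun s hs s' hs' => ?_⟩
  · rw [hocc s hs]
    exact hf.2.2.1 s hs
  · rw [hocc s hs, hocc s' hs']
    exact hf.2.2.2 s hs s' hs'

variable [NeZero d]

theorem le_plevel_of_mem_varWords (hT : ∀ i, IsTree (T i)) {D : ∀ j, Set (T j)} {m n k : ℕ}
    {f : PWord Λ T} (hf : f ∈ varWords D m n) (hD : IsVectorLevelSubset D k)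
    {s t : LevelProduct T} (h : f t = some (Sum.inr s)) : k ≤ plevel t := by
  have hs := hf.2.1 t s h
  rw [← hD.plevel_eq hs]
  exact plevel_mono hT ((hf.2.2.1 s hs).2 h)

theorem IsProbe.union (hT : ∀ i, IsTree (T i)) {X : ℕ → PWord Λ T} (F : Frame X) {r n : ℕ}
    {f y : PWord Λ T} (hf : IsProbe X n f) (hy : y ∈ spanUpTo r X) (hr : F.N r ≤ n) :
    IsProbe X n (y.union f) := by
  obtain ⟨D, k, N, h1, h2, h3, h4, h5, h6⟩ := hf
  have hydom := F.dom_of_mem_spanUpTo hy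
  have hyX : y ∈ fullSpan X := Set.mem_iUnion.2 ⟨r, hy⟩
  refine ⟨D, k, N, h1, h2, h3, mem_varWords_of_occ_eq h4 ?_ ?_ ?_, h5, fun a => ?_⟩
  · rw [PWord.dom_union, hydom, h4.1]
    ext t
    simp only [Set.mem_union, mem_slab_iff]
    omega
  · intro t s h
    by_cases ht : t ∈ y.dom
    · rw [PWord.union_apply_of_mem ht] at h
      obtain ⟨b, hb⟩ := unionUpTo_mem_varFree hy h
      simp at hb
    · rwa [PWord.union_apply_of_notMem ht] at h
  · intro s hs t h
    rw [PWord.union_apply_of_notMem, h]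
    rw [hydom, mem_slab_iff]
    have := le_plevel_of_mem_varWords hT h4 h1 h
    omega
  · rw [PWord.subst_union, PWord.subst_eq_self (varFree_of_mem_fullSpan hyX)]
    exact F.union_mem_fullSpan hyX (h6 a)

/-- The ultrafilters every member of which contains all the instances of some variable words. -/
def probeUltrafilters (X : ℕ → PWord Λ T) : Set (Ultrafilter (PWord Λ T)) :=
  {p | ∀ A ∈ p, ∀ n, ∃ f, IsProbe X n f ∧ ∀ a, f.subst a ∈ A}

omit [NeZero d] in
theorem isClosed_probeUltrafilters (X : ℕ → PWord Λ T) : IsClosed (probeUltrafilters X) := by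
  have : probeUltrafilters X =
      ⋂ A ∈ {A : Set (PWord Λ T) | ¬ ∀ n, ∃ f, IsProbe X n f ∧ ∀ a, f.subst a ∈ A},
        {u : Ultrafilter (PWord Λ T) | A ∈ u}ᶜ := by
    ext p
    simp only [Set.mem_iInter]
    constructor
    · intro hp A hA hAp
      exact hA (hp A hAp)
    · intro hp A hAp
      by_contra hA
      exact hp A hA hAp
  rw [this]
  exact isClosed_biInter fun A _ => (ultrafilter_isOpen_basic A).isClosed_compl

variable [Finite Λ] [Nonempty Λ] (hT : ∀ i, IsTree (T i))
  (hh : ∀ i, HasHeight (T i) Cardinal.aleph0) {X : ℕ → PWord Λ T} (F : Frame X)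
include hT hh F

/-- If every ultrafilter had a bad member `A p`, finitely many of these would cover all words by
compactness. Color each word by one that contains it: a monochromatic probe at the maximum of their
levels is a contradiction. -/
theorem nonempty_probeUltrafilters : (probeUltrafilters X).Nonempty := by
  by_contra hne
  have hno : ∀ p : Ultrafilter (PWord Λ T), ∃ A ∈ p, ∃ n, ¬ ∃ f, IsProbe X n f ∧
      ∀ a, f.subst a ∈ A := by
    intro p
    by_contra h
    push Not at h
    exact hne ⟨p, fun A hA n => h A hA n⟩
  choose A hA n hn using hno
  obtain ⟨t, ht⟩ := CompactSpace.elim_nhds_subcover (fun p => {u | A p ∈ u})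
    fun p => (ultrafilter_isOpen_basic (A p)).mem_nhds (hA p)
  have hcov : ∀ w : PWord Λ T, ∃ p : t, w ∈ A p := by
    intro w
    have : (pure w : Ultrafilter (PWord Λ T)) ∈ ⋃ p ∈ t, {u | A p ∈ u} := by
      rw [ht]
      trivial
    obtain ⟨p, hp, h⟩ := Set.mem_iUnion₂.1 this
    exact ⟨⟨p, hp⟩, h⟩
  choose c hc using hcov
  obtain ⟨f, hf, p, hp⟩ := F.exists_mono_probe hT hh (t.sup n) c
  exact hn p ⟨f, hf.mono hT hh (Finset.le_sup p.2), fun a => hp a ▸ hc (f.subst a)⟩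

attribute [local instance] Ultrafilter.semigroup

/-- Closure under products holds because prefixing a word `y` of the span to a probe whose variables
start above `y` gives a probe again; then the Ellis–Numakura lemma applies. -/
theorem exists_idempotent_probeUltrafilter :
    ∃ p ∈ probeUltrafilters X, p * p = p := by
  refine exists_idempotent_in_compact_subsemigroup Ultrafilter.continuous_mul_left _
    (nonempty_probeUltrafilters hT hh F) (isClosed_probeUltrafilters X).isCompact ?_
  intro p hp p' hp' A hA n
  have hX : fullSpan X ∈ p := by
    by_contra h
    obtain ⟨f, hf, hfA⟩ := hp _ (Ultrafilter.compl_mem_iff_notMem.2 h) 0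
    obtain ⟨D, k, N, -, -, -, -, -, h6⟩ := hf
    exact hfA _ (h6 fun _ => Classical.arbitrary Λ)
  have hA' : ∀ᶠ y in (p : Filter (PWord Λ T)), ∀ᶠ z in (p' : Filter (PWord Λ T)), y * z ∈ A :=
    (Ultrafilter.eventually_mul p p' (· ∈ A)).1 hA
  obtain ⟨y, hy, hyX⟩ := (hA'.and hX).exists
  obtain ⟨r, hr⟩ := Set.mem_iUnion.1 hyX
  -- The bound `F.N r` is the top of `y`, so that `y` overwrites no variable of `f`.
  obtain ⟨f, hf, hfA⟩ := hp' _ hy (max n (F.N r))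
  refine ⟨y.union f, (hf.union hT F hr (le_max_right _ _)).mono hT hh (le_max_left _ _),
    fun a => ?_⟩
  rw [PWord.subst_union, PWord.subst_eq_self (varFree_of_mem_fullSpan hyX)]
  exact hfA a

omit [Nonempty Λ] in
theorem finite_fullSpan_dom (m : ℕ) : {w ∈ fullSpan X | w.dom = slab T 0 m}.Finite := by
  refine ((Set.finite_Iic m).biUnion fun r _ => F.finite_spanUpTo hT r).subset ?_
  rintro w ⟨hw, hd⟩
  obtain ⟨r, hr⟩ := Set.mem_iUnion.1 hw
  refine Set.mem_iUnion₂.2 ⟨r, ?_, hr⟩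
  rw [F.dom_of_mem_spanUpTo hr] at hd
  exact (F.strictMono.le_apply).trans ((slab_zero_subset_iff hT hh).1 hd.subset)

end Pigeonhole

/-! ### Continuing the first blocks of a subspace -/

section Build

variable {Λ : Type*} {d : ℕ} {T : Fin d → Type*} [∀ i, PartialOrder (T i)]

/-- The restriction of a word to the levels from `m` on. -/
noncomputable def PWord.above (m : ℕ) (f : PWord Λ T) : PWord Λ T :=
  fun t => if m ≤ plevel t then f t else none

theorem PWord.union_subst_above [NeZero d] {m : ℕ} {f h : PWord Λ T} (hd : h.dom = slab T 0 m)
    (a : LevelProduct T → Λ) : h.union ((f.above m).subst a) = h.union (f.subst a) := by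
  funext t
  by_cases ht : t ∈ h.dom
  · rw [PWord.union_apply_of_mem ht, PWord.union_apply_of_mem ht]
  · rw [PWord.union_apply_of_notMem ht, PWord.union_apply_of_notMem ht]
    rw [hd, mem_slab_iff] at ht
    rw [PWord.subst, PWord.subst, PWord.above, if_pos (by omega)]

theorem above_mem_varWords [NeZero d] (hT : ∀ i, IsTree (T i)) {D : ∀ j, Set (T j)} {k m N : ℕ}
    {f : PWord Λ T} (hf : f ∈ varWords D 0 N) (hD : IsVectorLevelSubset D k) (hm : m ≤ k) :
    f.above m ∈ varWords D m N := by
  refine mem_varWords_of_occ_eq hf ?_ ?_ ?_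
  · ext t
    have : t ∈ f.dom ↔ t ∈ slab T 0 N := by rw [hf.1]
    rw [PWord.mem_dom, mem_slab_iff] at this
    rw [PWord.mem_dom, mem_slab_iff, PWord.above]
    split_ifs with h <;> simp_all
  · intro t s h
    rw [PWord.above] at h
    split_ifs at h
    exact h
  · intro s _ t h
    have := le_plevel_of_mem_varWords hT hf hD h
    rw [PWord.above, if_pos (by omega), h]

variable [NeZero d] [Finite Λ]

/-- If every finite set of good words can be extended by all the instances of variable words of
`Y`, then the first blocks of `X` can be continued to a subspace all of whose words that extend
the given good word `x` are good. -/
theorem exists_continuation (hT : ∀ i, IsTree (T i))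
    (hh : ∀ i, HasHeight (T i) Cardinal.aleph0) {X Y : ℕ → PWord Λ T} (F : Frame X)
    (hYX : fullSpan Y ⊆ fullSpan X) {q : ℕ} {x : PWord Λ T} (hx : x ∈ spanUpTo q X)
    (Good : Set (PWord Λ T)) (hxG : x ∈ Good)
    (step : ∀ G ⊆ Good, G.Finite → ∀ n, ∃ f, IsProbe Y n f ∧
      ∀ g ∈ G, ∀ a, g.union (f.subst a) ∈ Good) :
    ∃ Z : ℕ → PWord Λ T, IsSubspace Z ∧ (∀ i < q, Z i = X i) ∧
      (∀ r, spanUpTo r Z ⊆ fullSpan X) ∧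
      ∀ r, ∀ z ∈ spanUpTo r Z, Extends x z → z ∈ Good := by
  have step' : ∀ n m, ∃ (f : PWord Λ T) (D : ∀ j, Set (T j)) (k N : ℕ),
      (∀ g ∈ Good, g ∈ fullSpan X → g.dom = slab T 0 m → ∀ a, g.union (f.subst a) ∈ Good) ∧
      IsVectorLevelSubset D k ∧ n ≤ k ∧ k < N ∧ f ∈ varWords D 0 N ∧
      (∀ j, Dominates (D j) {t : T j | level t = n}) ∧ ∀ a, f.subst a ∈ fullSpan Y := by
    intro n m
    -- Only finitely many words of the span end at level `m`, so one probe serves all good ones.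
    obtain ⟨f, ⟨D, k, N, h⟩, hf⟩ := step ({w ∈ fullSpan X | w.dom = slab T 0 m} ∩ Good)
      Set.inter_subset_right ((finite_fullSpan_dom hT hh F m).subset Set.inter_subset_left) n
    exact ⟨f, D, k, N, fun g hg hgX hgd => hf g ⟨⟨hgX, hgd⟩, hg⟩, h⟩
  choose f D k N hG hD hnk hkN hf hdom hfY using step'
  let m : ℕ → ℕ := fun j => Nat.rec (F.N q) (fun j m => N (max (q + j) m) m) j
  -- `q + j` is the level that the new block has to dominate; `m j` keeps its variables above the
  -- previous blocks, so that cutting off the lower levels loses none.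
  let n : ℕ → ℕ := fun j => max (q + j) (m j)
  have hm : ∀ j, m (j + 1) = N (n j) (m j) := fun _ => rfl
  let Z : ℕ → PWord Λ T := fun i => if i < q then X i else (f (n (i - q)) (m (i - q))).above
    (m (i - q))
  have hZlt : ∀ i < q, Z i = X i := fun i hi => if_pos hi
  have hZge : ∀ j, Z (q + j) = (f (n j) (m j)).above (m j) := by
    intro j
    simp only [Z]
    rw [if_neg (by omega), Nat.add_sub_cancel_left]
  let N' : ℕ → ℕ := fun i => if i < q then F.N i else m (i - q)
  have hN'le : ∀ i ≤ q, N' i = F.N i := by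
    intro i hi
    rcases hi.lt_or_eq with h | rfl
    · exact if_pos h
    · simp [N', m]
  have hN'ge : ∀ j, N' (q + j) = m j := by
    intro j
    simp only [N']
    rw [if_neg (by omega), Nat.add_sub_cancel_left]
  have hcases : ∀ i, i < q ∨ ∃ j, i = q + j := fun i =>
    (Nat.lt_or_ge i q).imp_right Nat.exists_eq_add_of_le
  have hframe : ∀ i, ∃ (k' : ℕ) (D' : ∀ j, Set (T j)), N' i ≤ k' ∧ k' < N' (i + 1) ∧
      IsVectorLevelSubset D' k' ∧ Z i ∈ varWords D' (N' i) (N' (i + 1)) ∧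
      ∀ j, Dominates (D' j) {t : T j | level t = i} := by
    intro i
    rcases hcases i with hi | ⟨j, rfl⟩
    · rw [hN'le i hi.le, hN'le (i + 1) hi, hZlt i hi]
      exact ⟨F.k i, F.D i, F.le i, F.lt i, F.vlevel i, F.varWord i, F.dominates i⟩
    · rw [hN'ge, add_assoc, hN'ge, hZge, hm]
      have h1 : m j ≤ k (n j) (m j) := (le_max_right _ _).trans (hnk (n j) (m j))
      exact ⟨k (n j) (m j), D (n j) (m j), h1, hkN _ _, hD _ _,
        above_mem_varWords hT (hf _ _) (hD _ _) h1,
        fun c => (hdom _ _ c).mono (hT c) (hh c) (le_max_left _ _)⟩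
  choose k' D' h1 h2 h3 h4 h5 using hframe
  let F' : Frame Z := ⟨N', k', D', by rw [hN'le 0 (Nat.zero_le _), F.zero], h1, h2, h3, h4, h5⟩
  have hdomx := F.dom_of_mem_spanUpTo hx
  have key : ∀ j, ∀ z ∈ spanUpTo (q + j) Z, z ∈ fullSpan X ∧
      ((∀ t ∈ x.dom, z t = x t) → z ∈ Good) := by
    intro j
    induction j with
    | zero =>
      intro z hz
      rw [add_zero, spanUpTo_congr hZlt] at hz
      refine ⟨Set.mem_iUnion.2 ⟨q, hz⟩, fun h => ?_⟩
      rwa [← eq_of_extends_of_dom_subset h]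
      rw [hdomx, F.dom_of_mem_spanUpTo hz]
    | succ j ih =>
      intro z hz
      rw [← add_assoc] at hz
      obtain ⟨w, hw, a, rfl⟩ := mem_spanUpTo_succ.1 hz
      have hwd : w.dom = slab T 0 (m j) := by
        rw [F'.dom_of_mem_spanUpTo hw, ← hN'ge j]
      obtain ⟨hwX, hwG⟩ := ih w hw
      -- Below level `m j` the word `w` wins, so the truncated block may be replaced by the full
      -- probe, whose instances lie in the span of `Y`.
      rw [hZge, PWord.union_subst_above hwd]
      refine ⟨F.union_mem_fullSpan hwX (hYX (hfY _ _ a)), fun h => ?_⟩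
      refine hG _ _ w (hwG fun t ht => ?_) hwX hwd a
      rw [← h t ht, PWord.union_apply_of_mem]
      rw [hwd, mem_slab_iff]
      rw [hdomx, mem_slab_iff] at ht
      have h6 : F.N q ≤ m j := by
        have := F'.strictMono.monotone (Nat.le_add_right q j)
        change N' q ≤ N' (q + j) at this
        rwa [hN'ge, hN'le q le_rfl] at this
      omega
  refine ⟨Z, F'.isSubspace hT hh, hZlt, fun r z hz => ?_, fun r z hz he => ?_⟩
  · rcases hcases r with hr | ⟨j, rfl⟩
    · rw [spanUpTo_congr fun i hi => hZlt i (by omega)] at hz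
      exact Set.mem_iUnion.2 ⟨r, hz⟩
    · exact (key j z hz).1
  · have hxZ : x ∈ spanUpTo q Z := by rwa [spanUpTo_congr hZlt]
    obtain ⟨j, rfl⟩ := Nat.exists_eq_add_of_le (F'.lt_of_extends hT hh hxZ hz he).le
    exact (key j z hz).2 he.1

variable [Nonempty Λ]

/-- Take the span of `Y` as the good words: it is closed under unions, so any probe of `Y` extends
them. -/
theorem exists_amalgamation (hT : ∀ i, IsTree (T i))
    (hh : ∀ i, HasHeight (T i) Cardinal.aleph0) {X Y : ℕ → PWord Λ T} (F : Frame X)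
    (F' : Frame Y) (hYX : fullSpan Y ⊆ fullSpan X) {q : ℕ} {x : PWord Λ T}
    (hx : x ∈ spanUpTo q X) (hxY : x ∈ fullSpan Y) :
    ∃ Z : ℕ → PWord Λ T, IsSubspace Z ∧ (∀ i < q, Z i = X i) ∧
      (∀ r, spanUpTo r Z ⊆ fullSpan X) ∧
      ∀ r, ∀ z ∈ spanUpTo r Z, Extends x z → z ∈ fullSpan Y := by
  refine exists_continuation hT hh F hYX hx _ hxY fun G hG _ n => ?_
  obtain ⟨f, hf, -⟩ := F'.exists_mono_probe hT hh n fun _ => ()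
  refine ⟨f, hf, fun g hg a => F'.union_mem_fullSpan (hG hg) ?_⟩
  obtain ⟨D, k, N, -, -, -, -, -, h6⟩ := hf
  exact h6 a

attribute [local instance] Ultrafilter.semigroup

-- The Galvin–Glazer argument. Idempotence yields `A' ∈ p` inside `{y | x * y ∈ O}` such that each
-- `y ∈ A'` has `p`-almost all products in `A'`. Hence finitely many words of `{x} ∪ x * A'` can be
-- extended together by all instances of one probe.
omit [Nonempty Λ] in
theorem exists_continuation_of_idempotent (hT : ∀ i, IsTree (T i))
    (hh : ∀ i, HasHeight (T i) Cardinal.aleph0) {X : ℕ → PWord Λ T} (F : Frame X)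
    {p : Ultrafilter (PWord Λ T)} (hp : p ∈ probeUltrafilters X) (hpp : p * p = p) {q : ℕ}
    {x : PWord Λ T} (hx : x ∈ spanUpTo q X) {O : Set (PWord Λ T)} (hO : {y | x * y ∈ O} ∈ p) :
    ∃ Z : ℕ → PWord Λ T, IsSubspace Z ∧ (∀ i < q, Z i = X i) ∧
      (∀ r, spanUpTo r Z ⊆ fullSpan X) ∧
      ∀ r, ∀ z ∈ spanUpTo r Z, Extends x z → z ∈ O := by
  have idem : ∀ {B : Set (PWord Λ T)}, B ∈ p →
      ∀ᶠ y in (p : Filter (PWord Λ T)), {z | y * z ∈ B} ∈ p := by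
    intro B hB
    rw [← hpp] at hB
    exact (Ultrafilter.eventually_mul p p (· ∈ B)).1 hB
  let A : Set (PWord Λ T) := {y | x * y ∈ O}
  let A' : Set (PWord Λ T) := {y | y ∈ A ∧ {z | y * z ∈ A} ∈ p}
  have hA' : A' ∈ p := Filter.inter_mem hO (idem hO)
  have hA'' : ∀ y ∈ A', {z | y * z ∈ A'} ∈ p := by
    rintro y ⟨-, hy⟩
    refine Filter.inter_mem hy ?_
    refine Filter.mem_of_superset (idem hy) fun z hz => ?_
    change {w | y * z * w ∈ A} ∈ p
    have hz : {w | y * (z * w) ∈ A} ∈ p := hz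
    simpa only [mul_assoc] using hz
  let Good : Set (PWord Λ T) := insert x {w | ∃ y ∈ A', w = x * y}
  have hGood : ∀ g ∈ Good, {z | g * z ∈ Good} ∈ p := by
    rintro g (rfl | ⟨y, hy, rfl⟩)
    · exact Filter.mem_of_superset hA' fun z hz => Or.inr ⟨z, hz, rfl⟩
    · refine Filter.mem_of_superset (hA'' y hy) fun z hz => Or.inr ⟨y * z, hz, ?_⟩
      rw [mul_assoc]
  obtain ⟨Z, h1, h2, h3, h4⟩ := exists_continuation hT hh F subset_rfl hx Good
    (Set.mem_insert _ _) fun G hG hfin n => by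
      obtain ⟨f, hf, hfG⟩ := hp (⋂ g ∈ G, {z | g * z ∈ Good})
        ((Filter.biInter_mem hfin).2 fun g hg => hGood g (hG hg)) n
      exact ⟨f, hf, fun g hg a => Set.mem_iInter₂.1 (hfG a) g hg⟩
  refine ⟨Z, h1, h2, h3, fun r z hz he => ?_⟩
  rcases h4 r z hz he with rfl | ⟨y, hy, rfl⟩
  · exact absurd rfl he.2
  · exact hy.1

theorem exists_pigeonhole (hT : ∀ i, IsTree (T i))
    (hh : ∀ i, HasHeight (T i) Cardinal.aleph0) {X : ℕ → PWord Λ T} (F : Frame X) {q : ℕ}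
    {x : PWord Λ T} (hx : x ∈ spanUpTo q X) (O : Set (PWord Λ T)) :
    ∃ Z : ℕ → PWord Λ T, IsSubspace Z ∧ (∀ i < q, Z i = X i) ∧
      (∀ r, spanUpTo r Z ⊆ fullSpan X) ∧
      ((∀ r, ∀ z ∈ spanUpTo r Z, Extends x z → z ∈ O) ∨
        ∀ r, ∀ z ∈ spanUpTo r Z, Extends x z → z ∉ O) := by
  obtain ⟨p, hp, hpp⟩ := exists_idempotent_probeUltrafilter hT hh F
  by_cases hO : {y | x * y ∈ O} ∈ p
  · obtain ⟨Z, h1, h2, h3, h4⟩ := exists_continuation_of_idempotent hT hh F hp hpp hx hO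
    exact ⟨Z, h1, h2, h3, Or.inl h4⟩
  · obtain ⟨Z, h1, h2, h3, h4⟩ := exists_continuation_of_idempotent hT hh F hp hpp hx
      (O := Oᶜ) (Ultrafilter.compl_mem_iff_notMem.2 hO)
    exact ⟨Z, h1, h2, h3, Or.inr h4⟩

end Build

/-! ### The space of sequences of constant words -/

section WordSeq

variable {Λ : Type*} {d : ℕ} {T : Fin d → Type*} [∀ i, PartialOrder (T i)]

theorem IsSubspace.of_local {Y : ℕ → PWord Λ T}
    (h : ∀ n, ∃ X : ℕ → PWord Λ T, IsSubspace X ∧ ∀ i < n, X i = Y i) : IsSubspace Y where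
  compatible i := by
    obtain ⟨X, hX, e⟩ := h (i + 2)
    rw [← e i (by omega), ← e (i + 1) (by omega)]
    exact hX.compatible i
  varWord i := by
    obtain ⟨X, hX, e⟩ := h (i + 1)
    rw [← e i (by omega)]
    exact hX.varWord i
  bot_eq := by
    obtain ⟨X, hX, e⟩ := h 1
    rw [← e 0 (by omega)]
    exact hX.bot_eq

variable [NeZero d]

/-- The unions of the initial segments of a sequence of constant words. -/
def WordSeq.partialUnion (A : WordSeq Λ T) (n : ℕ) : PWord Λ T :=
  PWord.unionUpTo (fun i => (A.1 i).word) n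

theorem WordSeq.exists_dom_eq (hT : ∀ i, IsTree (T i))
    (hh : ∀ i, HasHeight (T i) Cardinal.aleph0) (A : WordSeq Λ T) :
    ∃ m : ℕ → ℕ, StrictMono m ∧ (∀ i, (A.1 i).word.dom = slab T (m i) (m (i + 1))) ∧
      ∀ n, (A.partialUnion n).dom = slab T 0 (m n) := by
  obtain ⟨A, hne, hcomp, hbot⟩ := A
  choose m n hmn hA using fun i => (A i).2
  have hd : ∀ i, (A i).word.dom = slab T (m i) (n i) := fun i => (hA i).1
  have h := fun i => top_bot_of_dom_eq_of_ne_empty hT hh (hd i) (hne i)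
  have hnm : ∀ i, n i = m (i + 1) := by
    intro i
    rcases hcomp i with h1 | h1 | h1
    · exact absurd h1 (hne i)
    · exact absurd h1 (hne _)
    · rw [← (h i).2.2, h1, (h (i + 1)).2.1]
  have hmono : StrictMono m := strictMono_nat_of_lt_succ fun i => (h i).1.trans_eq (hnm i)
  have hd' : ∀ i, (A i).word.dom = slab T (m i) (m (i + 1)) := fun i => hnm i ▸ hd i
  refine ⟨m, hmono, hd', fun k => ?_⟩
  induction k with
  | zero =>
    have h0 : m 0 = 0 := (h 0).2.1.symm.trans hbot
    rw [h0, slab_eq_empty le_rfl]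
    exact PWord.dom_empty
  | succ k ih =>
    have ih : (PWord.unionUpTo (fun i => (A i).word) k).dom = slab T 0 (m k) := ih
    change (PWord.unionUpTo (fun i => (A i).word) (k + 1)).dom = _
    rw [PWord.unionUpTo, PWord.dom_union, ih, hd',
      slab_union (Nat.zero_le _) (hmono.monotone (Nat.le_succ k))]

theorem WordSeq.extends_partialUnion (hT : ∀ i, IsTree (T i))
    (hh : ∀ i, HasHeight (T i) Cardinal.aleph0) (A : WordSeq Λ T) (n : ℕ) :
    Extends (A.partialUnion n) (A.partialUnion (n + 1)) := by
  refine ⟨fun t ht => PWord.union_apply_of_mem ht, fun e => ?_⟩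
  obtain ⟨m, hm, -, hd⟩ := A.exists_dom_eq hT hh
  have h := (hd (n + 1)).symm.trans ((congrArg PWord.dom e).symm.trans (hd n))
  exact absurd ((slab_zero_subset_iff hT hh).1 h.subset) (hm (Nat.lt_succ_self n)).not_ge

/-- Each word is the difference of two consecutive partial unions. Hence basic open conditions on
the words become conditions on finite approximations. -/
theorem WordSeq.eq_of_partialUnion_eq (hT : ∀ i, IsTree (T i))
    (hh : ∀ i, HasHeight (T i) Cardinal.aleph0) {A A' : WordSeq Λ T} {i : ℕ}
    (h₀ : A.partialUnion i = A'.partialUnion i)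
    (h₁ : A.partialUnion (i + 1) = A'.partialUnion (i + 1)) : A.1 i = A'.1 i := by
  have key : ∀ (A : WordSeq Λ T) t, (t ∈ (A.partialUnion i).dom → (A.1 i).word t = none) ∧
      (t ∉ (A.partialUnion i).dom → (A.1 i).word t = A.partialUnion (i + 1) t) := by
    intro A t
    obtain ⟨m, hm, hd, hd'⟩ := A.exists_dom_eq hT hh
    refine ⟨fun ht => PWord.notMem_dom.1 ?_, fun ht => (PWord.union_apply_of_notMem ht).symm⟩
    rw [hd', mem_slab_iff] at ht
    rw [hd, mem_slab_iff]
    omega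
  refine Subtype.ext (funext fun t => ?_)
  change (A.1 i).word t = (A'.1 i).word t
  by_cases ht : t ∈ (A.partialUnion i).dom
  · rw [(key A t).1 ht, (key A' t).1 (h₀ ▸ ht)]
  · rw [(key A t).2 ht, (key A' t).2 (h₀ ▸ ht), h₁]

/-- An open set of sequences contains with a sequence all that agree with it on a certain
initial segment. -/
theorem WordSeq.exists_initial_of_isOpen (hT : ∀ i, IsTree (T i))
    (hh : ∀ i, HasHeight (T i) Cardinal.aleph0) {U : Set (WordSeq Λ T)} (hU : IsOpen U)
    {A : WordSeq Λ T} (hA : A ∈ U) :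
    ∃ n, ∀ A' : WordSeq Λ T, RamseySystem.initial A'.partialUnion n =
      RamseySystem.initial A.partialUnion n → A' ∈ U := by
  obtain ⟨V, hV, rfl⟩ := isOpen_induced_iff.1 hU
  obtain ⟨I, u, hu, hIV⟩ := isOpen_pi_iff.1 hV _ hA
  refine ⟨I.sup id + 1, fun A' hA' => hIV fun i hi => ?_⟩
  rw [RamseySystem.initial_eq_iff] at hA'
  have hi' : i ≤ I.sup id := Finset.le_sup (f := id) hi
  have := WordSeq.eq_of_partialUnion_eq hT hh (hA' i (by omega)) (hA' (i + 1) (by omega))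
  simp only [this]
  exact (hu i hi).2

/-- The system allows the empty word in spans but `seqSpan` does not; words using at least one block
are nonempty, so nothing is lost. -/
theorem seqSpan_subset_of_spanUpTo_subset (hT : ∀ i, IsTree (T i))
    (hh : ∀ i, HasHeight (T i) Cardinal.aleph0) {X Y : ℕ → PWord Λ T} (F : Frame Y)
    (h : ∀ r, spanUpTo r Y ⊆ fullSpan X) : seqSpan Y ⊆ seqSpan X := by
  intro w hw
  rw [seqSpan_eq] at hw ⊢
  obtain ⟨q, hq⟩ := Set.mem_iUnion.1 hw
  obtain ⟨r, hr⟩ := Set.mem_iUnion.1 (h _ hq)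
  cases r with
  | zero =>
    have hlt : 0 < F.N (q + 1) := (Nat.zero_le _).trans_lt (F.strictMono (Nat.lt_succ_self q))
    exact absurd (eq_empty_of_mem_spanUpTo_zero hr)
      (ne_empty_of_dom_eq hT hh (F.dom_of_mem_spanUpTo hq) hlt)
  | succ r => exact Set.mem_iUnion.2 ⟨r, hr⟩

variable [Finite Λ] [Nonempty Λ]

variable (Λ) in
/-- The Ramsey system of subspaces and sequences of constant words. -/
def ramseySystem (hT : ∀ i, IsTree (T i)) (hh : ∀ i, HasHeight (T i) Cardinal.aleph0) :
    RamseySystem (PWord Λ T) (PWord Λ T) (WordSeq Λ T) where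
  Sub := IsSubspace
  Sp := spanUpTo
  R := Extends
  val := WordSeq.partialUnion
  sub_of_local _ h := IsSubspace.of_local h
  sp_congr _ _ _ h := spanUpTo_congr h
  sp_finite q _ hX := (hX.nonempty_frame hT hh).elim fun F => F.finite_spanUpTo hT q
  depth_lt _ _ _ _ _ hX hx hy h :=
    (hX.nonempty_frame hT hh).elim fun F => F.lt_of_extends hT hh hx hy h
  rel_trans _ _ _ h h' := h.trans h'
  rel_val A n := A.extends_partialUnion hT hh n
  pigeonhole _ _ _ O hX hx :=
    (hX.nonempty_frame hT hh).elim fun F => exists_pigeonhole hT hh F hx O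
  amalgamation _ _ _ _ r hX hY hYX hx hxY :=
    (hX.nonempty_frame hT hh).elim fun F => (hY.nonempty_frame hT hh).elim fun F' =>
      exists_amalgamation hT hh F F' (Set.iUnion_subset hYX) hx (Set.mem_iUnion.2 ⟨r, hxY⟩)

theorem SouslinMeasurable.ramsey (hT : ∀ i, IsTree (T i))
    (hh : ∀ i, HasHeight (T i) Cardinal.aleph0) {E : Set (WordSeq Λ T)}
    (hE : SouslinMeasurable E) : (ramseySystem Λ hT hh).Ramsey E := by
  induction hE with
  | of_isOpen U hU =>
    exact RamseySystem.Ramsey.of_open fun A hA => WordSeq.exists_initial_of_isOpen hT hh hU hA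
  | compl A _ ih => exact ih.compl
  | union A B _ _ ihA ihB => exact ihA.union ihB
  | souslin A _ ih => exact RamseySystem.Ramsey.souslin ih

theorem infSpan_subset_points (hT : ∀ i, IsTree (T i))
    (hh : ∀ i, HasHeight (T i) Cardinal.aleph0) (X : ℕ → PWord Λ T) :
    infSpan X ⊆ (ramseySystem Λ hT hh).points X := by
  intro A hA n
  cases n with
  | zero => exact Set.mem_iUnion.2 ⟨0, empty_mem_spanUpTo X⟩
  | succ n =>
    have h := hA (n + 1) (by omega)
    rw [seqSpan_eq] at h
    obtain ⟨q, hq⟩ := Set.mem_iUnion.1 h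
    exact Set.mem_iUnion.2 ⟨q + 1, hq⟩

end WordSeq

/-- The first word of a point is nonempty. So an empty alphabet admits no points, and the main
theorem is vacuous in that case. -/
theorem WordSeq.nonempty_alphabet {Λ : Type*} {d : ℕ} {T : Fin d → Type*}
    [∀ i, PartialOrder (T i)] (A : WordSeq Λ T) : Nonempty Λ := by
  by_contra hΛ
  refine A.2.1 0 (funext fun t => ?_)
  rcases ht : (A.1 0).word t with _ | y
  · rfl
  · obtain ⟨m, n, -, -, h⟩ := (A.1 0).2
    obtain ⟨a, -⟩ := h t y ht
    exact absurd ⟨a⟩ hΛ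

end TreeHJ

theorem mainTheorem3 {d : ℕ} (hd : 0 < d)
    (T : Fin d → Type*) [∀ i, PartialOrder (T i)]
    (hT : ∀ i, TreeHJ.IsTree (T i)) (hheight : ∀ i, TreeHJ.HasHeight (T i) Cardinal.aleph0)
    (Λ : Type*) [Finite Λ] {C : Type*} [Finite C]
    (c : TreeHJ.WordSeq Λ T → C) (hc : ∀ j : C, TreeHJ.SouslinMeasurable (c ⁻¹' {j}))
    (X : ℕ → TreeHJ.PWord Λ T) (hX : TreeHJ.IsSubspace X) :
    ∃ X' : ℕ → TreeHJ.PWord Λ T, TreeHJ.IsSubspace X' ∧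
      TreeHJ.seqSpan X' ⊆ TreeHJ.seqSpan X ∧
      ∀ A ∈ TreeHJ.infSpan X', ∀ B ∈ TreeHJ.infSpan X', c A = c B := by
  have : NeZero d := ⟨hd.ne'⟩
  by_cases hΛ : Nonempty Λ
  · obtain ⟨Y, hY, hle, hcol⟩ := TreeHJ.RamseySystem.exists_le_decides_finite
      (S := TreeHJ.ramseySystem Λ hT hheight) c (fun j => (hc j).ramsey hT hheight)
      (e := TreeHJ.PWord.empty) (fun _ => rfl) hX (TreeHJ.empty_mem_spanUpTo X)
    obtain ⟨F⟩ := TreeHJ.IsSubspace.nonempty_frame hT hheight hY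
    exact ⟨Y, hY, TreeHJ.seqSpan_subset_of_spanUpTo_subset hT hheight F hle, fun A hA B hB =>
      hcol A (TreeHJ.infSpan_subset_points hT hheight Y hA)
        B (TreeHJ.infSpan_subset_points hT hheight Y hB)⟩
  · exact ⟨X, hX, subset_rfl, fun A _ => absurd A.nonempty_alphabet hΛ⟩
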